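/- **Theorem 4.2 (Temporal Sparse Incomparability Lemma).** A finite relational type $\tau$ consists of finitely many relational symbols with arities. A homomorphism is a map of the universes that preserves all relations, and $\mathbf A\to\mathbf B$ means that there is one. A structure $\mathbf T$ of type $\tau$ with universe $\mathbb Q$ is *temporal* if each of its relations is invariant under all automorphisms of $(\mathbb Q,<)$. A *cycle* of length $t\ge 2$ in $\mathbf A$ is a sequence $x_0,r_1,x_1,\dots,r_t,x_t=x_0$ of distinct elements $x_0,\dots,x_{t-1}$ and distinct relational tuples $r_1,\dots,r_t$ of $\mathbf A$ (tuples of different relations count as different) such that $x_{i-1}$ and $x_i$ are coordinates of $r_i$ for $1\le i\le t$; a cycle of length $1$ is a relational tuple with two identical coordinates. The *girth* of $\mathbf A$ is the shortest length of a cycle, and $\infty$ if there is no cycle. Let $g\ge 0$ be an integer, $\tau$ a finite relational type and $\mathbf B$ a finite structure of type $\tau$ with universe $B$. If $g\ge 2$, assume that no relational tuple of $\mathbf B$ has two identical coordinates. Then there is a finite structure $\underline{\mathbf B}$ of type $\tau$ such that 1. $\underline{\mathbf B}$ has girth at least $g$; 2. $\underline{\mathbf B}\to\mathbf B$; 3.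 for every temporal structure $\mathbf T$ of type $\tau$, if $\underline{\mathbf B}\to\mathbf T$ then $\mathbf B\to\mathbf T$. Moreover, $\underline{\mathbf B}$ can be computed in randomized polynomial time: for all fixed $g$, $\tau$ and $c\in\mathbb N$ there are a randomized algorithm (a program for a random access machine with addition and subtraction, unit cost per instruction, and fair coin flips) and a polynomial $p$ such that on every input $\mathbf B$ as above with universe $\{0,\dots,m-1\}$, where $m=|B|$, the algorithm halts after at most $p(m)$ steps for all outcomes of the coin flips, and with probability at least $1-(m+2)^{-c}$ it outputs a structure $\underline{\mathbf B}$ with properties 1, 2 and 3. Input and output structures are encoded as bit strings: the size of the universe in unary, followed by the tables of the relations. -/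

import Mathlib

universe u

/-! ### Relational structures of finite type -/

/-- A finite relational type: finitely many relational symbols, each with an arity. -/
structure Signature where
  /-- the number of relational symbols -/
  numSymbols : ℕ
  /-- the arity of each symbol -/
  arity : Fin numSymbols → ℕ

/-- The relational symbols of `τ`. -/
abbrev Signature.Symbol (τ : Signature) : Type := Fin τ.numSymbols

/-- A relational structure of type `τ` with universe `V`: a set of tuples for every symbol. -/
structure RelStructure (τ : Signature) (V : Type u) where
  /-- `rel R` is the set of tuples that belong to the relation `R` -/
  rel : (R : τ.Symbol) → Set (Fin (τ.arity R) → V)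

namespace RelStructure

variable {τ : Signature}

/-- There is a homomorphism `A → B`: a map of the universes that preserves all relations. -/
def MapsTo {V W : Type*} (A : RelStructure τ V) (B : RelStructure τ W) : Prop :=
  ∃ f : V → W, ∀ R : τ.Symbol, ∀ t ∈ A.rel R, f ∘ t ∈ B.rel R

/-- A structure on `ℚ` is temporal if all its relations are invariant under all automorphisms
of the ordered set `ℚ`. -/
def IsTemporal (T : RelStructure τ ℚ) : Prop :=
  ∀ e : ℚ ≃o ℚ, ∀ R : τ.Symbol, ∀ t : Fin (τ.arity R) → ℚ, t ∈ T.rel R ↔ e ∘ t ∈ T.rel R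

/-- No relational tuple of `A` has two identical coordinates. -/
def Nondegenerate {V : Type*} (A : RelStructure τ V) : Prop :=
  ∀ R : τ.Symbol, ∀ t ∈ A.rel R, Function.Injective t

/-- The relational tuples of `A`. Tuples of different relations count as different. -/
def Tuple {V : Type*} (A : RelStructure τ V) : Type _ :=
  Σ R : τ.Symbol, A.rel R

/-- The element `v` belongs to the relational tuple `t`. -/
def Tuple.Contains {V : Type*} {A : RelStructure τ V} (t : A.Tuple) (v : V) : Prop :=
  v ∈ Set.range t.2.1

/-- `A` has a cycle of length `n`. Either `n = 1` and some relational tuple has two identical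
coordinates, or `n ≥ 2` and there are distinct elements `x i` and distinct tuples `r i`, indexed
cyclically, such that `r i` contains `x i` and the next element `x (i + 1)`. -/
def HasCycle {V : Type*} (A : RelStructure τ V) (n : ℕ) : Prop :=
  (n = 1 ∧ ¬ A.Nondegenerate) ∨
  (2 ≤ n ∧ ∃ (x : Fin n → V) (r : Fin n → A.Tuple), Function.Injective x ∧ Function.Injective r ∧
    ∀ i, (r i).Contains (x i) ∧ (r i).Contains (x (finRotate n i)))

/-- The shortest length of a cycle of `A`, and `⊤` if there is no cycle. -/
noncomputable def girth {V : Type*} (A : RelStructure τ V) : ℕ∞ :=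
  ⨅ n ∈ {n : ℕ | A.HasCycle n}, (n : ℕ∞)

/-- `C` has girth at least `g`, it maps to `B`, and `B` maps to every temporal structure to which
`C` maps. -/
def IsTemporalSparsification {V W : Type*} (g : ℕ) (B : RelStructure τ V)
    (C : RelStructure τ W) : Prop :=
  (g : ℕ∞) ≤ C.girth ∧ C.MapsTo B ∧
    ∀ T : RelStructure τ ℚ, T.IsTemporal → C.MapsTo T → B.MapsTo T

open Classical in
/-- The table of the relation `R`: one bit for each of the `m ^ k` tuples, `k` being the arity, where
the tuple `t` stands at position `∑ i, t i * m ^ i`. -/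
noncomputable def table {m : ℕ} (A : RelStructure τ (Fin m)) (R : τ.Symbol) : List Bool :=
  List.ofFn fun j : Fin (m ^ τ.arity R) => decide (finFunctionFinEquiv.symm j ∈ A.rel R)

/-- The encoding of a structure with universe `{0, …, m - 1}` as a bit string: `m` in unary,
a zero, and then the tables of the relations. -/
noncomputable def encode {m : ℕ} (A : RelStructure τ (Fin m)) : List Bool :=
  List.replicate m true ++ [false] ++ (List.ofFn fun R : τ.Symbol => A.table R).flatten

end RelStructure

/-! ### Random access machines with coin flips

The machine has registers and an indirectly addressable memory, both holding natural numbers, and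
an output to which it appends bits. Every instruction takes one unit of time. As addition and
subtraction are the only arithmetic, numbers grow by at most one bit per instruction. -/

namespace RAM

/-- Programs. Registers are named by natural numbers. -/
inductive Program : Type
  /-- do nothing -/
  | skip : Program
  /-- `x := c` for a constant `c` -/
  | const (x c : ℕ) : Program
  /-- `x := y + z` -/
  | add (x y z : ℕ) : Program
  /-- `x := y - z`, truncated at zero -/
  | sub (x y z : ℕ) : Program
  /-- `x := mem[y]` -/
  | load (x y : ℕ) : Program
  /-- `mem[x] := y` -/
  | store (x y : ℕ) : Program
  /-- `x :=` the next random bit -/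
  | flip (x : ℕ) : Program
  /-- append the bit `x ≠ 0` to the output -/
  | write (x : ℕ) : Program
  /-- `p` followed by `q` -/
  | seq (p q : Program) : Program
  /-- if `x ≠ 0` then `p` else `q` -/
  | ite (x : ℕ) (p q : Program) : Program
  /-- while `x ≠ 0` do `p` -/
  | loop (x : ℕ) (p : Program) : Program

/-- States of the machine; `coins` are the random bits that have not been used yet. -/
structure State where
  /-- the registers -/
  reg : ℕ → ℕ
  /-- the memory -/
  mem : ℕ → ℕ
  /-- the output so far -/
  out : List Bool
  /-- the unused random bits -/
  coins : ℕ → Bool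

/-- Set the register `x` to `v`. -/
def State.set (s : State) (x v : ℕ) : State :=
  { s with reg := Function.update s.reg x v }

/-- `Exec p s n s'`: started in the state `s`, the program `p` halts after exactly `n` units of
time in the state `s'`. -/
inductive Exec : Program → State → ℕ → State → Prop
  | skip (s : State) : Exec .skip s 1 s
  | const (x c : ℕ) (s : State) : Exec (.const x c) s 1 (s.set x c)
  | add (x y z : ℕ) (s : State) : Exec (.add x y z) s 1 (s.set x (s.reg y + s.reg z))
  | sub (x y z : ℕ) (s : State) : Exec (.sub x y z) s 1 (s.set x (s.reg y - s.reg z))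
  | load (x y : ℕ) (s : State) : Exec (.load x y) s 1 (s.set x (s.mem (s.reg y)))
  | store (x y : ℕ) (s : State) :
      Exec (.store x y) s 1 { s with mem := Function.update s.mem (s.reg x) (s.reg y) }
  | flip (x : ℕ) (s : State) :
      Exec (.flip x) s 1 { s.set x (s.coins 0).toNat with coins := fun i => s.coins (i + 1) }
  | write (x : ℕ) (s : State) :
      Exec (.write x) s 1 { s with out := s.out ++ [decide (s.reg x ≠ 0)] }
  | seq {p q : Program} {s s₁ s₂ : State} {n₁ n₂ : ℕ} :
      Exec p s n₁ s₁ → Exec q s₁ n₂ s₂ → Exec (.seq p q) s (n₁ + n₂) s₂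
  | ite_true {x : ℕ} {p q : Program} {s s₁ : State} {n : ℕ} :
      s.reg x ≠ 0 → Exec p s n s₁ → Exec (.ite x p q) s (n + 1) s₁
  | ite_false {x : ℕ} {p q : Program} {s s₁ : State} {n : ℕ} :
      s.reg x = 0 → Exec q s n s₁ → Exec (.ite x p q) s (n + 1) s₁
  | loop_stop {x : ℕ} {p : Program} {s : State} :
      s.reg x = 0 → Exec (.loop x p) s 1 s
  | loop_step {x : ℕ} {p : Program} {s s₁ s₂ : State} {n₁ n₂ : ℕ} :
      s.reg x ≠ 0 → Exec p s n₁ s₁ → Exec (.loop x p) s₁ n₂ s₂ →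
        Exec (.loop x p) s (n₁ + n₂ + 1) s₂

/-- The initial state: the input bits are in the memory cells `0, 1, …`, everything else is zero. -/
def init (input : List Bool) (coins : ℕ → Bool) : State where
  reg _ := 0
  mem i := (input.getD i false).toNat
  out := []
  coins := coins

/-- On the given input and sequence of random bits, `p` halts within time `n` with output `w`. -/
def HaltsWith (p : Program) (input : List Bool) (coins : ℕ → Bool) (n : ℕ) (w : List Bool) :
    Prop :=
  ∃ k ≤ n, ∃ s : State, Exec p (init input coins) k s ∧ s.out = w

/-- The probability that `p`, run for time at most `n` on the given input with independent fair
random bits, halts with an output in `S`. In time `n` at most `n` random bits are used,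
so it suffices to count strings of `n` random bits. -/
noncomputable def prob (p : Program) (input : List Bool) (n : ℕ) (S : Set (List Bool)) : ℝ :=
  Nat.card {ρ : Fin n → Bool // ∃ w ∈ S,
    HaltsWith p input (fun i => if h : i < n then ρ ⟨i, h⟩ else false) n w} / 2 ^ n

end RAM

/-! Replace every element of `B` by a fibre of `n` points, where `n` is polynomial in `m`. Replace
every tuple `t` of `B` by random lifts, whose coordinates are drawn independently and uniformly from
the fibres over the coordinates of `t`, and discard every lift that lies on a cycle shorter than
`g`. Projection to the base is a homomorphism to `B`, and the deletion forces the girth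
(`le_girth_sparseLift`).

Let `f` map the lift to a temporal structure `T`. Every fibre contains a subset `S b`, of density of
order `1 / m`, such that for `b ≠ b'` the values of `f` on `S b` and `S b'` are either completely
separated or all equal (`exists_comparable_subsets`). Choose `x b ∈ S b`. If a surviving lift of `t`
has its coordinates in the sets `S (t c)`, its image has the same order type as the points `f (t c,
x (t c))`. Since `ℚ` is homogeneous (`exists_orderIso_extending`), an automorphism carries one to
the other, so `b ↦ f (b, x b)` preserves `t`.

It remains to find such a surviving lift in every large box. Let `A` be the maximal arity and `D = 8
* (m + 1)`. With `D ^ A * n * (A + 1)` lifts per pattern, a given box with sides of density `1 / D`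
is missed with probability at most `2 ^ (-n * (A + 1))`, which beats the at most `2 ^ (n * A)` boxes
in a union bound. On the other hand, the number of lifts is linear in `n`, so the expected number of
short cycles is bounded by a polynomial in `m` that does not involve `n`. For large `n`, Markov's
inequality shows that the points where short cycles are glued occupy at most a fraction `1 / D` of a
fibre. Removing them from the sides of a box leaves it large, and a lift inside the smaller box lies
on no short cycle. Both estimates are combined in `card_bad_arrays_mul_le`.

For the algorithm, `n` is a power of two, so fair coins give exactly uniform entries. The coins are
first stored behind the input. The rest is deterministic: since `g` and the type are fixed, every
test is a brute force search with a bounded number of nested loops. The closure properties of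
`Comp`, `Decides` and `Writes` assemble the program. Existence over an arbitrary finite universe
follows because the success probability is positive. For `g < 2` the structure `B` itself serves. -/

/-! ### Homogeneity of countable dense linear orders -/

/-- A finite partial isomorphism of a countable dense linear order without endpoints extends to an
automorphism. -/
theorem exists_orderIso_extending {ι α : Type*} [Finite ι] [LinearOrder α] [Countable α]
    [DenselyOrdered α] [NoMinOrder α] [NoMaxOrder α] [Nonempty α] (x y : ι → α)
    (h : ∀ i j, cmp (x i) (x j) = cmp (y i) (y j)) : ∃ e : α ≃o α, ∀ i, e (x i) = y i := by
  classical
  cases nonempty_fintype ι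
  cases nonempty_encodable α
  let p : Order.PartialIso α α := ⟨Finset.univ.image fun i => (x i, y i), by
    simp only [Finset.mem_image, Finset.mem_univ, true_and]
    rintro _ ⟨i, rfl⟩ _ ⟨j, rfl⟩
    exact h i j⟩
  -- Back and forth: the ideal contains `p` and meets, for every point, the partial isomorphisms
  -- with that point in their domain and those with it in their range.
  let to_cofinal : α ⊕ α → Order.Cofinal (Order.PartialIso α α) := fun p ↦
    Sum.recOn p (Order.PartialIso.definedAtLeft α) (Order.PartialIso.definedAtRight α)
  let I : Order.Ideal (Order.PartialIso α α) := Order.idealOfCofinals p to_cofinal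
  let F a := Order.PartialIso.funOfIdeal a I
    (Order.cofinal_meets_idealOfCofinals _ to_cofinal (Sum.inl a))
  let G b := Order.PartialIso.invOfIdeal b I
    (Order.cofinal_meets_idealOfCofinals _ to_cofinal (Sum.inr b))
  refine ⟨OrderIso.ofCmpEqCmp (fun a ↦ (F a).val) (fun b ↦ (G b).val) fun a b ↦ ?_, fun i ↦ ?_⟩
  · rcases (F a).prop with ⟨f, hf, ha⟩
    rcases (G b).prop with ⟨g, hg, hb⟩
    rcases I.directed _ hf _ hg with ⟨m, _, fm, gm⟩
    exact m.prop (a, _) (fm ha) (_, b) (gm hb)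
  · change (F (x i)).val = y i
    rcases (F (x i)).prop with ⟨f, hf, ha⟩
    have hp : p ∈ I := Order.mem_idealOfCofinals p to_cofinal
    rcases I.directed _ hf _ hp with ⟨m, _, fm, pm⟩
    have h1 : (x i, y i) ∈ m.val := pm (Finset.mem_image_of_mem _ (Finset.mem_univ i))
    have := m.prop (x i, (F (x i)).val) (fm ha) (x i, y i) h1
    simpa using this.symm

/-! ### Large subsets of the fibres that are ordered like points -/

/-- A family of fibres that is labelled by elements of a linear order has large subsets any two of
which are either separated or constant with the same value. -/
theorem exists_comparable_subsets {ι κ α : Type*} [LinearOrder α] (f : ι → κ → α) (s : ℕ)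
    (hs : 0 < s) (I : Finset ι) (U : ι → Finset κ) (hU : ∀ b ∈ I, s * I.card ≤ (U b).card) :
    ∃ S : ι → Finset κ, (∀ b ∈ I, S b ⊆ U b ∧ s ≤ 2 * (S b).card) ∧
      ∀ b ∈ I, ∀ b' ∈ I, b ≠ b' →
        (∀ x ∈ S b, ∀ y ∈ S b', f b x < f b' y) ∨ (∀ x ∈ S b, ∀ y ∈ S b', f b' y < f b x) ∨
          (∀ x ∈ S b, ∀ y ∈ S b', f b x = f b' y) := by
  classical
  induction hn : I.card using Nat.strong_induction_on generalizing I U with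
  | _ n ih =>
  subst hn
  rcases I.eq_empty_or_nonempty with rfl | hI
  · exact ⟨U, by simp, by simp⟩
  have hcard : 0 < I.card := hI.card_pos
  -- the least value below which some fibre has at least `s` points
  let V : Finset α := (I.sigma U).image fun p => f p.1 p.2
  let P : Finset α := V.filter fun q => ∃ b ∈ I, s ≤ ((U b).filter fun x => f b x ≤ q).card
  have memP : ∀ b ∈ I, ∀ W ⊆ U b, s ≤ W.card → ∃ q ∈ P, (∃ x ∈ W, q = f b x) ∧
      ∀ x ∈ W, f b x ≤ q := by
    intro b hb W hW hc
    have hne : W.Nonempty := Finset.card_pos.1 (by omega)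
    obtain ⟨x, hx, hmax⟩ := Finset.exists_max_image W (f b) hne
    refine ⟨f b x, Finset.mem_filter.2 ⟨Finset.mem_image.2 ⟨⟨b, x⟩, ?_, rfl⟩, b, hb, ?_⟩,
      ⟨x, hx, rfl⟩, hmax⟩
    · exact Finset.mem_sigma.2 ⟨hb, hW hx⟩
    · exact hc.trans (Finset.card_le_card fun y hy => Finset.mem_filter.2 ⟨hW hy, hmax y hy⟩)
  have hP : P.Nonempty := by
    obtain ⟨b, hb⟩ := hI
    obtain ⟨q, hq, -⟩ := memP b hb (U b) subset_rfl
      (le_trans (Nat.le_mul_of_pos_right s hcard) (hU b hb))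
    exact ⟨q, hq⟩
  -- By minimality every fibre has fewer than `s` points strictly below `q`, while some fibre has at
  -- least `s` points up to `q`. So each round costs a remaining fibre fewer than `s` points and
  -- settles at least one fibre, which preserves the hypothesis `s * I.card ≤ (U b).card`.
  let q := P.min' hP
  have hqP : q ∈ P := P.min'_mem hP
  let lo : ι → Finset κ := fun b => (U b).filter fun x => f b x < q
  let eq : ι → Finset κ := fun b => (U b).filter fun x => f b x = q
  have hlo : ∀ b ∈ I, (lo b).card < s := by
    intro b hb
    by_contra! hc
    obtain ⟨q', hq', ⟨x, hx, rfl⟩, -⟩ := memP b hb (lo b) (Finset.filter_subset _ _) hc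
    exact absurd (P.min'_le _ hq') (not_le.2 (Finset.mem_filter.1 hx).2)
  obtain ⟨b₀, hb₀, hb₀s⟩ := (Finset.mem_filter.1 hqP).2
  have hsplit : ((U b₀).filter fun x => f b₀ x ≤ q).card ≤ (lo b₀).card + (eq b₀).card := by
    refine le_trans (Finset.card_le_card ?_) (Finset.card_union_le _ _)
    intro x hx
    simp only [Finset.mem_filter, Finset.mem_union, lo, eq] at hx ⊢
    rcases hx.2.lt_or_eq with h | h
    · exact Or.inl ⟨hx.1, h⟩
    · exact Or.inr ⟨hx.1, h⟩
  -- If some fibre has `s / 2` points below `q`, they are separated from what is left of the others.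
  -- Otherwise at least one fibre has `s / 2` points with value exactly `q`; all such fibres are
  -- settled together with the common value `q`, and the others keep only their points above `q`.
  by_cases hA : ∃ b ∈ I, s ≤ 2 * (lo b).card
  · obtain ⟨b₁, hb₁, hb₁s⟩ := hA
    have hlt : (I.erase b₁).card < I.card := Finset.card_erase_lt_of_mem hb₁
    obtain ⟨S, hS, hcmp⟩ := ih _ hlt (I.erase b₁) (fun b => U b \ lo b) (by
      intro b hb
      have hb' := Finset.mem_of_mem_erase hb
      have h1 := Finset.le_card_sdiff (lo b) (U b)
      have h2 := hU b hb'
      have h3 := hlo b hb'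
      have h4 : s * (I.erase b₁).card + s ≤ s * I.card := by
        rw [← Nat.mul_succ]; exact Nat.mul_le_mul_left s hlt
      omega) rfl
    have hup : ∀ b ∈ I, b ≠ b₁ → ∀ x ∈ S b, q ≤ f b x := by
      intro b hb hne x hx
      have := (hS b (Finset.mem_erase.2 ⟨hne, hb⟩)).1 hx
      simp only [lo, Finset.mem_sdiff, Finset.mem_filter, not_and, not_lt] at this
      exact this.2 this.1
    have hdn : ∀ x ∈ lo b₁, f b₁ x < q := fun x hx => (Finset.mem_filter.1 hx).2
    refine ⟨fun b => if b = b₁ then lo b else S b, ?_, ?_⟩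
    · intro b hb
      by_cases h : b = b₁
      · subst h; simpa using ⟨Finset.filter_subset _ _, hb₁s⟩
      · have := hS b (Finset.mem_erase.2 ⟨h, hb⟩)
        simp only [h, if_false]
        exact ⟨this.1.trans Finset.sdiff_subset, this.2⟩
    · intro b hb b' hb' hne
      by_cases h : b = b₁
      · subst h
        have h' : b' ≠ b := fun h => hne h.symm
        simp only [if_true, h', if_false]
        exact Or.inl fun x hx y hy => (hdn x hx).trans_le (hup b' hb' h' y hy)
      · by_cases h' : b' = b₁
        · subst h'
          simp only [if_true, h, if_false]
          exact Or.inr (Or.inl fun x hx y hy => (hdn y hy).trans_le (hup b hb h x hx))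
        · simp only [h, h', if_false]
          exact hcmp b (Finset.mem_erase.2 ⟨h, hb⟩) b' (Finset.mem_erase.2 ⟨h', hb'⟩) hne
  · push Not at hA
    let E : Finset ι := I.filter fun b => s ≤ 2 * (eq b).card
    have hb₀E : b₀ ∈ E := Finset.mem_filter.2 ⟨hb₀, by have := hA b₀ hb₀; omega⟩
    have hlt : (I \ E).card < I.card :=
      Finset.card_lt_card (Finset.sdiff_ssubset (Finset.filter_subset _ _) ⟨b₀, hb₀E⟩)
    obtain ⟨S, hS, hcmp⟩ := ih _ hlt (I \ E) (fun b => U b \ (lo b ∪ eq b)) (by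
      intro b hb
      obtain ⟨hb', hbE⟩ := Finset.mem_sdiff.1 hb
      have h1 := Finset.le_card_sdiff (lo b ∪ eq b) (U b)
      have h2 := hU b hb'
      have h3 := hA b hb'
      have h5 : 2 * (eq b).card < s := by
        by_contra! h; exact hbE (Finset.mem_filter.2 ⟨hb', h⟩)
      have h6 := Finset.card_union_le (lo b) (eq b)
      have h4 : s * (I \ E).card + s ≤ s * I.card := by
        rw [← Nat.mul_succ]; exact Nat.mul_le_mul_left s hlt
      omega) rfl
    have hup : ∀ b ∈ I, b ∉ E → ∀ x ∈ S b, q < f b x := by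
      intro b hb hE x hx
      have := (hS b (Finset.mem_sdiff.2 ⟨hb, hE⟩)).1 hx
      simp only [lo, eq, Finset.mem_sdiff, Finset.mem_union, Finset.mem_filter] at this
      push Not at this
      exact lt_of_le_of_ne (this.2.1 this.1) (this.2.2 this.1).symm
    have hdn : ∀ b, ∀ x ∈ eq b, f b x = q := fun b x hx => (Finset.mem_filter.1 hx).2
    refine ⟨fun b => if b ∈ E then eq b else S b, ?_, ?_⟩
    · intro b hb
      by_cases h : b ∈ E
      · simp only [h, if_true]
        exact ⟨Finset.filter_subset _ _, (Finset.mem_filter.1 h).2⟩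
      · have := hS b (Finset.mem_sdiff.2 ⟨hb, h⟩)
        simp only [h, if_false]
        exact ⟨this.1.trans Finset.sdiff_subset, this.2⟩
    · intro b hb b' hb' hne
      by_cases h : b ∈ E <;> by_cases h' : b' ∈ E <;> simp only [h, h', if_true, if_false]
      · exact Or.inr (Or.inr fun x hx y hy => (hdn b x hx).trans (hdn b' y hy).symm)
      · exact Or.inl fun x hx y hy => (hdn b x hx).trans_lt (hup b' hb' h' y hy)
      · exact Or.inr (Or.inl fun x hx y hy => (hdn b' y hy).trans_lt (hup b hb h x hx))
      · exact hcmp b (Finset.mem_sdiff.2 ⟨hb, h⟩) b' (Finset.mem_sdiff.2 ⟨hb', h'⟩) hne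

/-! ### Lifted structures -/

/-- A cycle of length `j` in an array of tuples: distinct rows `r`, and in each row two
positions `a ≠ b`, such that the entry at `b` agrees with the entry at `a` of the next row. -/
structure IsArrayCycle {I K X : Type*} (ω : I → K → X) {j : ℕ} (r : Fin j → I)
    (a b : Fin j → K) : Prop where
  injective : Function.Injective r
  ne : ∀ l, a l ≠ b l
  glue : ∀ l, ω (r l) (b l) = ω (r (finRotate j l)) (a (finRotate j l))

/-- The row `i` lies on a cycle of length at least `2` and less than `g`. -/
def OnShortCycle {I K X : Type*} (g : ℕ) (ω : I → K → X) (i : I) : Prop :=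
  ∃ j, 2 ≤ j ∧ j < g ∧ ∃ (r : Fin j → I) (a b : Fin j → K), IsArrayCycle ω r a b ∧ ∃ l, r l = i

/-- The tuples over the vertices `{0, …, m - 1}`, for all symbols. -/
abbrev Signature.Pattern (τ : Signature) (m : ℕ) : Type :=
  Σ R : τ.Symbol, Fin (τ.arity R) → Fin m

namespace RelStructure

variable {τ : Signature}

/-- Every tuple `t` of `B` is lifted to the rows `idx t l` of the array `ω`, apart from those that
lie on short cycles of the array. -/
def sparseLift (g : ℕ) {m n L A : ℕ} {I : Type*} (hA : ∀ R, τ.arity R ≤ A)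
    (idx : τ.Pattern m × Fin L → I) (ω : I → Fin A → Fin n)
    (B : RelStructure τ (Fin m)) : RelStructure τ (Fin (m * n)) where
  rel R := {w | ∃ t ∈ B.rel R, ∃ l, ¬ OnShortCycle g ω (idx (⟨R, t⟩, l)) ∧
    w = fun c => finProdFinEquiv (t c, ω (idx (⟨R, t⟩, l)) (Fin.castLE (hA R) c))}

theorem le_girth_iff {V : Type*} {A : RelStructure τ V} {g : ℕ} :
    (g : ℕ∞) ≤ A.girth ↔ ∀ n, A.HasCycle n → g ≤ n := by
  simp [girth, le_iInf_iff]

/-- A pattern together with a row number determines both the symbol and the entries of a lifted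
tuple. Hence distinct tuples on a cycle come from distinct rows of the array. -/
theorem tuple_eq_of_pattern_eq {m L : ℕ} {V : Type*} {A : RelStructure τ V} {p q : A.Tuple}
    (F : (s : τ.Pattern m × Fin L) → Fin (τ.arity s.1.1) → V) {t t' l l'}
    (hp : p.2.1 = F (⟨p.1, t⟩, l)) (hq : q.2.1 = F (⟨q.1, t'⟩, l'))
    (h : ((⟨p.1, t⟩, l) : τ.Pattern m × Fin L) = (⟨q.1, t'⟩, l')) : p = q := by
  obtain ⟨R, w, hw⟩ := p
  obtain ⟨R', w', hw'⟩ := q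
  simp only at hp hq h
  cases h
  obtain rfl : w = w' := hp.trans hq.symm
  rfl

/-! ### Girth of the lift, and transfer of homomorphisms to temporal structures -/

section sparseLift

variable {g m n L A : ℕ} {I : Type*} {hA : ∀ R, τ.arity R ≤ A}
  {idx : τ.Pattern m × Fin L → I} {ω : I → Fin A → Fin n} {B : RelStructure τ (Fin m)}

theorem sparseLift_mapsTo : (sparseLift g hA idx ω B).MapsTo B := by
  refine ⟨fun v => (finProdFinEquiv.symm v).1, ?_⟩
  rintro R w ⟨t, ht, l, -, rfl⟩
  have h : (fun v => (finProdFinEquiv.symm v).1) ∘ (fun c =>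
      finProdFinEquiv (t c, ω (idx (⟨R, t⟩, l)) (Fin.castLE (hA R) c))) = t := by
    funext c
    simp only [Function.comp_apply, Equiv.symm_apply_apply]
  rwa [h]

/-- A short cycle in the lift gives, on forgetting the fibres, a short cycle of the array, but the
rows on such cycles have been removed. Cycles of length one are excluded because the base
coordinates of a lifted tuple are already distinct. -/
theorem le_girth_sparseLift (hidx : Function.Injective idx) (hB : B.Nondegenerate) :
    (g : ℕ∞) ≤ (sparseLift g hA idx ω B).girth := by
  rw [le_girth_iff]
  rintro j (⟨-, hdeg⟩ | ⟨hj, x, r, hx, hr, hxr⟩)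
  · refine absurd ?_ hdeg
    rintro R w ⟨t, ht, l, -, rfl⟩ c c' h
    simp only [EmbeddingLike.apply_eq_iff_eq, Prod.mk.injEq] at h
    exact hB R t ht h.1
  by_contra! hlt
  choose t ht l hbad hw using fun i => (r i).2.2
  let row : Fin j → I := fun i => idx (⟨(r i).1, t i⟩, l i)
  choose ca hca using fun i => (hxr i).1
  choose cb hcb using fun i => (hxr i).2
  rw [forall_congr' fun i => by rw [hw i]] at hca hcb
  have hj0 : 0 < j := by omega
  have key : IsArrayCycle ω row (fun i => Fin.castLE (hA _) (ca i))
      (fun i => Fin.castLE (hA _) (cb i)) := by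
    refine ⟨?_, ?_, ?_⟩
    · intro i i' h
      refine hr (tuple_eq_of_pattern_eq
        (fun s c => finProdFinEquiv (s.1.2 c, ω (idx s) (Fin.castLE (hA s.1.1) c))) (hw i) (hw i') (hidx h))
    · intro i h
      -- As `j ≥ 2`, consecutive vertices of the cycle are distinct, so they occupy different
      -- columns of their common row.
      have hrot : finRotate j i ≠ i := by
        obtain ⟨j, rfl⟩ : ∃ k, j = k + 2 := ⟨j - 2, by omega⟩
        simp
      have h' : ca i = cb i := Fin.castLE_injective _ h
      refine hrot (hx ((hcb i).symm.trans ?_))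
      rw [← h', hca i]
    · intro i
      have h1 := (hcb i).trans (hca (finRotate j i)).symm
      simp only [EmbeddingLike.apply_eq_iff_eq, Prod.mk.injEq] at h1
      exact h1.2
  exact hbad ⟨0, hj0⟩ ⟨j, hj, hlt, row, _, _, key, ⟨0, hj0⟩, rfl⟩

/-- Every row on a short cycle meets `X`, so a row in a box that avoids `X` survives. On the sets
from `exists_comparable_subsets` the order type of the image of such a row is that of the chosen
representatives, and homogeneity concludes. -/
theorem mapsTo_temporal_of_sparseLift_mapsTo (hB : B.Nondegenerate) (hmn : m + 1 ≤ n)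
    (X : Finset (Fin n)) (hX : ∀ i, OnShortCycle g ω i → ∃ a, ω i a ∈ X)
    (hXn : X.card * (8 * (m + 1)) ≤ n)
    (hbox : ∀ s, ∀ S : Fin A → Finset (Fin n), (∀ c, n ≤ (S c).card * (8 * (m + 1))) →
      ∃ l, ∀ c, ω (idx (s, l)) c ∈ S c)
    {T : RelStructure τ ℚ} (hT : T.IsTemporal) (h : (sparseLift g hA idx ω B).MapsTo T) :
    B.MapsTo T := by
  classical
  obtain ⟨f, hf⟩ := h
  have hs : 0 < n / (m + 1) := Nat.div_pos hmn (Nat.succ_pos m)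
  obtain ⟨S, hS, hcmp⟩ := exists_comparable_subsets
    (fun (b : Fin m) (x : Fin n) => f (finProdFinEquiv (b, x))) (n / (m + 1)) hs Finset.univ
    (fun _ => Finset.univ) (by
      intro b _
      simp only [Finset.card_univ, Fintype.card_fin]
      exact le_trans (Nat.mul_le_mul_left _ (Nat.le_succ m)) (Nat.div_mul_le_self n (m + 1)))
  have hne : ∀ b, (S b).Nonempty := fun b =>
    Finset.card_pos.1 (by have := (hS b (Finset.mem_univ b)).2; omega)
  choose x hx using hne
  -- The constant 8 is a product of three factors 2: one for the halving in
  -- `exists_comparable_subsets`, one for rounding in `n / (m + 1)`, and one for the loss of `X`.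
  have hlarge : ∀ b, n ≤ (S b \ X).card * (8 * (m + 1)) := by
    intro b
    have h1 := (hS b (Finset.mem_univ b)).2
    have h2 := Finset.le_card_sdiff X (S b)
    have h3 : n < (n / (m + 1) + 1) * (m + 1) := Nat.lt_mul_of_div_lt (Nat.lt_succ_self _)
      (Nat.succ_pos m)
    have h4 : (n / (m + 1) + 1) * (m + 1) ≤ 4 * (S b).card * (m + 1) :=
      Nat.mul_le_mul_right _ (by omega)
    have h5 : (S b).card * (8 * (m + 1)) ≤ ((S b \ X).card + X.card) * (8 * (m + 1)) :=
      Nat.mul_le_mul_right _ (by omega)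
    have h6 : (S b).card * (8 * (m + 1)) = 2 * (4 * (S b).card * (m + 1)) := by ring
    have h7 : ((S b \ X).card + X.card) * (8 * (m + 1)) =
      (S b \ X).card * (8 * (m + 1)) + X.card * (8 * (m + 1)) := by ring
    omega
  have hlarge' : n ≤ (Finset.univ \ X).card * (8 * (m + 1)) := by
    have h2 := Finset.le_card_sdiff X (Finset.univ : Finset (Fin n))
    rw [Finset.card_univ, Fintype.card_fin] at h2
    have h5 : n * (8 * (m + 1)) ≤ ((Finset.univ \ X).card + X.card) * (8 * (m + 1)) :=
      Nat.mul_le_mul_right _ (by omega)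
    have h7 : ((Finset.univ \ X).card + X.card) * (8 * (m + 1)) =
      (Finset.univ \ X).card * (8 * (m + 1)) + X.card * (8 * (m + 1)) := by ring
    have h8 : 2 * n ≤ n * (8 * (m + 1)) := by nlinarith
    omega
  refine ⟨fun b => f (finProdFinEquiv (b, x b)), fun R t ht => ?_⟩
  obtain ⟨l, hl⟩ := hbox ⟨R, t⟩
    -- Columns beyond the arity of `R` are unconstrained except that they avoid `X` as well, because
    -- a cycle of the array may be glued in such a column.
    (fun c => if hc : c.val < τ.arity R then S (t ⟨c, hc⟩) \ X else Finset.univ \ X) (by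
      intro c
      split_ifs
      · exact hlarge _
      · exact hlarge')
  have hbad : ¬ OnShortCycle g ω (idx (⟨R, t⟩, l)) := by
    intro hbad
    obtain ⟨a, ha⟩ := hX _ hbad
    have := hl a
    split_ifs at this <;> exact (Finset.mem_sdiff.1 this).2 ha
  have hlS : ∀ c, ω (idx (⟨R, t⟩, l)) (Fin.castLE (hA R) c) ∈ S (t c) := by
    intro c
    have := hl (Fin.castLE (hA R) c)
    simp only [Fin.val_castLE, c.2, dif_pos, Fin.eta] at this
    exact (Finset.mem_sdiff.1 this).1
  have hmem := hf R _ ⟨t, ht, l, hbad, rfl⟩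
  obtain ⟨e, he⟩ := exists_orderIso_extending
    (fun c => f (finProdFinEquiv (t c, ω (idx (⟨R, t⟩, l)) (Fin.castLE (hA R) c))))
    (fun c => f (finProdFinEquiv (t c, x (t c)))) (by
      intro i j
      by_cases hij : i = j
      · subst hij; simp
      -- Nondegeneracy is essential: inside a single fibre the order of the values is not
      -- controlled.
      have hne : t i ≠ t j := fun h => hij (hB R t ht h)
      rcases hcmp _ (Finset.mem_univ (t i)) _ (Finset.mem_univ (t j)) hne with h | h | h
      · rw [cmp_eq_lt_iff _ _ |>.2 (h _ (hlS i) _ (hlS j)),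
          cmp_eq_lt_iff _ _ |>.2 (h _ (hx _) _ (hx _))]
      · rw [cmp_eq_gt_iff _ _ |>.2 (h _ (hlS i) _ (hlS j)),
          cmp_eq_gt_iff _ _ |>.2 (h _ (hx _) _ (hx _))]
      · rw [cmp_eq_eq_iff _ _ |>.2 (h _ (hlS i) _ (hlS j)),
          cmp_eq_eq_iff _ _ |>.2 (h _ (hx _) _ (hx _))])
  rw [hT e] at hmem
  convert hmem
  ext c
  exact (he c).symm

end sparseLift

end RelStructure

/-! ### Random arrays -/

section RandomArray

open Finset

variable {I K X : Type*} [Fintype X]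

-- Overwrite the entries at `(r l, b l)` by arbitrary values `z l`. This is injective on pairs of a
-- cyclic array and a vector `z`: the rows are distinct, so `z` can be read off, and the lost
-- entries are recovered from those at `(r l, a l)`, which are untouched as `a l ≠ b l`. So each of
-- the `j` gluing equations costs a factor `Fintype.card X`.
open Classical in
theorem card_isArrayCycle_mul_le [Fintype I] [Fintype K] [DecidableEq I] [DecidableEq K]
    {j : ℕ} (r : Fin j → I) (a b : Fin j → K) :
    (univ.filter fun ω : I → K → X => IsArrayCycle ω r a b).card * Fintype.card X ^ j ≤
      Fintype.card (I → K → X) := by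
  by_cases hr : Function.Injective r ∧ ∀ l, a l ≠ b l
  swap
  · rw [filter_false_of_mem fun ω _ h => hr ⟨h.1, h.2⟩]
    simp
  obtain ⟨hr, hab⟩ := hr
  have hc : Fintype.card X ^ j = (univ : Finset (Fin j → X)).card := by simp
  rw [hc, ← card_product, ← card_univ]
  let F : (I → K → X) × (Fin j → X) → I → K → X := fun p i k =>
    if h : ∃ l, r l = i ∧ b l = k then p.2 h.choose else p.1 i k
  have hF1 : ∀ p l, F p (r l) (b l) = p.2 l := by
    intro p l
    have h : ∃ l', r l' = r l ∧ b l' = b l := ⟨l, rfl, rfl⟩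
    have : h.choose = l := hr h.choose_spec.1
    simp only [F, dif_pos h, this]
  have hF2 : ∀ p i k, (¬ ∃ l, r l = i ∧ b l = k) → F p i k = p.1 i k := by
    intro p i k h
    simp only [F, dif_neg h]
  refine card_le_card_of_injOn F (fun _ _ => mem_coe.2 (mem_univ _)) ?_
  rintro ⟨ω, z⟩ h ⟨ω', z'⟩ h' heq
  have hω := (mem_filter.1 (mem_product.1 (mem_coe.1 h)).1).2.glue
  have hω' := (mem_filter.1 (mem_product.1 (mem_coe.1 h')).1).2.glue
  have hz : z = z' := by
    funext l
    exact (hF1 (ω, z) l).symm.trans ((congrFun₂ heq _ _).trans (hF1 (ω', z') l))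
  have hout : ∀ i k, (¬ ∃ l, r l = i ∧ b l = k) → ω i k = ω' i k := by
    intro i k hik
    exact (hF2 (ω, z) i k hik).symm.trans ((congrFun₂ heq _ _).trans (hF2 (ω', z') i k hik))
  have hne : ∀ l, ¬ ∃ l', r l' = r l ∧ b l' = a l := by
    rintro l ⟨l', h1, h2⟩
    have := hr h1
    subst this
    exact hab _ h2.symm
  refine Prod.ext ?_ hz
  funext i k
  by_cases hik : ∃ l, r l = i ∧ b l = k
  · obtain ⟨l, rfl, rfl⟩ := hik
    rw [hω l, hω' l]
    exact hout _ _ (hne _)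
  · exact hout i k hik

open Classical in
/-- The entries of an array that glue together the rows of some short cycle. -/
noncomputable def cyclePoints (g : ℕ) (ω : I → K → X) : Finset X :=
  univ.filter fun y => ∃ j, 2 ≤ j ∧ j < g ∧ ∃ (r : Fin j → I) (a b : Fin j → K),
    IsArrayCycle ω r a b ∧ ∃ l, ω (r l) (a l) = y

theorem exists_mem_cyclePoints {g : ℕ} {ω : I → K → X} {i : I} (h : OnShortCycle g ω i) :
    ∃ a, ω i a ∈ cyclePoints g ω := by
  classical
  obtain ⟨j, hj, hjg, r, a, b, hc, l, rfl⟩ := h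
  exact ⟨a l, mem_filter.2 ⟨mem_univ _, j, hj, hjg, r, a, b, hc, l, rfl⟩⟩

open Classical in
theorem card_cyclePoints_le [Fintype I] [Fintype K] (g : ℕ) (ω : I → K → X) :
    (cyclePoints g ω).card ≤ ∑ j ∈ range g, (univ.filter
      fun q : (Fin j → I) × (Fin j → K) × (Fin j → K) =>
        IsArrayCycle ω q.1 q.2.1 q.2.2).card * j := by
  have hsub : cyclePoints g ω ⊆ (range g).biUnion fun j =>
      ((univ.filter fun q : (Fin j → I) × (Fin j → K) × (Fin j → K) =>
        IsArrayCycle ω q.1 q.2.1 q.2.2) ×ˢ (univ : Finset (Fin j))).image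
          fun p => ω (p.1.1 p.2) (p.1.2.1 p.2) := by
    intro y hy
    obtain ⟨j, -, hj, r, a, b, hc, l, rfl⟩ := (mem_filter.1 hy).2
    exact mem_biUnion.2 ⟨j, mem_range.2 hj, mem_image.2 ⟨((r, a, b), l),
      mem_product.2 ⟨mem_filter.2 ⟨mem_univ _, hc⟩, mem_univ _⟩, rfl⟩⟩
  refine (card_le_card hsub).trans (card_biUnion_le.trans (sum_le_sum fun j _ => ?_))
  refine card_image_le.trans ?_
  rw [card_product, card_univ, Fintype.card_fin]

/-- The expected number of gluing points on short cycles is bounded in terms of the average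
degree. -/
theorem sum_card_cyclePoints_le [Fintype I] [Fintype K] [DecidableEq I] [DecidableEq K]
    [Nonempty X] (g : ℕ) {W : ℕ} (hW1 : 1 ≤ W)
    (hW : Fintype.card I * Fintype.card K ^ 2 ≤ W * Fintype.card X) :
    ∑ ω : I → K → X, (cyclePoints g ω).card ≤ g * g * W ^ g * Fintype.card (I → K → X) := by
  classical
  have hX : 0 < Fintype.card X := Fintype.card_pos
  have main : ∀ j, ∑ ω : I → K → X, (univ.filter
      fun q : (Fin j → I) × (Fin j → K) × (Fin j → K) =>
        IsArrayCycle ω q.1 q.2.1 q.2.2).card ≤ W ^ j * Fintype.card (I → K → X) := by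
    intro j
    have h1 : ∑ ω : I → K → X, (univ.filter
        fun q : (Fin j → I) × (Fin j → K) × (Fin j → K) =>
          IsArrayCycle ω q.1 q.2.1 q.2.2).card =
        ∑ q : (Fin j → I) × (Fin j → K) × (Fin j → K),
          (univ.filter fun ω : I → K → X => IsArrayCycle ω q.1 q.2.1 q.2.2).card := by
      simp only [card_filter]
      exact sum_comm
    rw [h1]
    -- There are `(card I * card K ^ 2) ^ j` choices of rows and columns, and each is a cycle with
    -- probability at most `card X ^ (-j)`.
    refine Nat.le_of_mul_le_mul_right (c := Fintype.card X ^ j) ?_ (pow_pos hX j)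
    rw [sum_mul]
    refine (sum_le_sum fun q _ => card_isArrayCycle_mul_le q.1 q.2.1 q.2.2).trans ?_
    rw [sum_const, card_univ, smul_eq_mul, Fintype.card_prod, Fintype.card_prod,
      Fintype.card_fun, Fintype.card_fun, Fintype.card_fin]
    calc _ = (Fintype.card I * Fintype.card K ^ 2) ^ j * Fintype.card (I → K → X) := by ring
      _ ≤ (W * Fintype.card X) ^ j * Fintype.card (I → K → X) := by gcongr
      _ = _ := by ring
  calc ∑ ω : I → K → X, (cyclePoints g ω).card
      ≤ ∑ ω : I → K → X, ∑ j ∈ range g, (univ.filter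
        fun q : (Fin j → I) × (Fin j → K) × (Fin j → K) =>
          IsArrayCycle ω q.1 q.2.1 q.2.2).card * j := sum_le_sum fun ω _ => card_cyclePoints_le g ω
    _ = ∑ j ∈ range g, (∑ ω : I → K → X, (univ.filter
        fun q : (Fin j → I) × (Fin j → K) × (Fin j → K) =>
          IsArrayCycle ω q.1 q.2.1 q.2.2).card) * j := by
      rw [sum_comm]
      exact sum_congr rfl fun j _ => (sum_mul _ _ _).symm
    _ ≤ ∑ j ∈ range g, W ^ g * Fintype.card (I → K → X) * g := by
      refine sum_le_sum fun j hj => ?_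
      have hjg := (mem_range.1 hj).le
      exact Nat.mul_le_mul ((main j).trans
        (Nat.mul_le_mul_right _ (Nat.pow_le_pow_right hW1 hjg))) hjg
    _ = _ := by
      rw [sum_const, card_range, smul_eq_mul]; ring

/-- Bernoulli's inequality: `q` independent trials with success probability `b / N ≥ 1 / q` all fail
with probability at most one half. -/
theorem two_mul_sub_pow_le {N b q : ℕ} (hq : 0 < q) (hb : b ≤ N) (h : N ≤ b * q) :
    2 * (N - b) ^ q ≤ N ^ q := by
  obtain ⟨x, rfl⟩ := Nat.exists_eq_add_of_le hb
  rw [Nat.add_sub_cancel_left]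
  rcases Nat.eq_zero_or_pos x with rfl | hx
  · simp [hq.ne']
  have hx' : (0 : ℝ) < x := by exact_mod_cast hx
  have h1 : (1 : ℝ) + q * (b / x) ≤ (1 + b / x) ^ q :=
    one_add_mul_le_pow (le_trans (by norm_num) (div_nonneg (Nat.cast_nonneg b) hx'.le)) q
  have h2 : (1 : ℝ) ≤ q * (b / x) := by
    rw [← mul_div_assoc, one_le_div hx']
    have : x ≤ q * b := by nlinarith
    exact_mod_cast this
  have h3 : ((b : ℝ) + x) ^ q = (1 + b / x) ^ q * x ^ q := by
    rw [← mul_pow]; congr 1; field_simp; rw [add_comm]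
  have h4 : (2 : ℝ) * x ^ q ≤ (b + x) ^ q := by
    rw [h3]
    exact mul_le_mul_of_nonneg_right (by linarith) (pow_nonneg hx'.le q)
  exact_mod_cast h4

/-! ### Hitting all large boxes -/

variable {κ : Type*} {L : ℕ}

/-- Every box with large sides contains one of the rows that belong to `s`. -/
def HitsBoxes (D : ℕ) (idx : κ × Fin L → I) (ω : I → K → X) : Prop :=
  ∀ s, ∀ S : K → Finset X, (∀ c, Fintype.card X ≤ (S c).card * D) → ∃ l, ∀ c, ω (idx (s, l)) c ∈ S c

-- The rows that belong to `s` are distinct, hence independent, and each lands in the box with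
-- probability at least `D ^ (-card K)`. Every block of `D ^ card K` rows halves the probability of
-- a miss, and `L` consists of `card X * (card K + 1)` such blocks.
open Classical in
theorem card_missing_box_mul_le [Fintype I] [Fintype K] [DecidableEq I] [DecidableEq K]
    {D : ℕ} (hD : 0 < D) {idx : κ × Fin L → I}
    (hidx : Function.Injective idx)
    (hL : L = D ^ Fintype.card K * (Fintype.card X * (Fintype.card K + 1))) (s : κ)
    (S : K → Finset X) (hS : ∀ c, Fintype.card X ≤ (S c).card * D) :
    (univ.filter fun ω : I → K → X => ∀ l, ¬ ∀ c, ω (idx (s, l)) c ∈ S c).card *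
      2 ^ (Fintype.card X * (Fintype.card K + 1)) ≤ Fintype.card (I → K → X) := by
  let J : Finset I := univ.image fun l => idx (s, l)
  have hJ : J.card = L := by
    rw [card_image_of_injective, card_univ, Fintype.card_fin]
    intro l l' h
    exact (Prod.ext_iff.1 (hidx h)).2
  set b := (Fintype.piFinset S).card with hb
  have hset : (univ.filter fun ω : I → K → X => ∀ l, ¬ ∀ c, ω (idx (s, l)) c ∈ S c) =
      Fintype.piFinset fun i => if i ∈ J then (Fintype.piFinset S)ᶜ else univ := by
    ext ω
    simp only [mem_filter, mem_univ, true_and, Fintype.mem_piFinset]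
    constructor
    · intro h i
      split_ifs with hi
      · obtain ⟨l, -, rfl⟩ := mem_image.1 hi
        simpa [Fintype.mem_piFinset] using h l
      · exact mem_univ _
    · intro h l
      have := h (idx (s, l))
      rw [if_pos (mem_image_of_mem _ (mem_univ l))] at this
      simpa [Fintype.mem_piFinset] using this
  set N := Fintype.card (K → X) with hN
  have hbN : b ≤ N := card_le_univ _
  have hNb : N ≤ b * D ^ Fintype.card K := by
    rw [hN, hb, Fintype.card_fun, Fintype.card_piFinset, ← card_univ (α := K),
      ← prod_const, ← prod_const, ← prod_mul_distrib]
    exact prod_le_prod' fun c _ => hS c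
  have hpow := two_mul_sub_pow_le (pow_pos hD (Fintype.card K)) hbN hNb
  have hcard : (Fintype.piFinset fun i => if i ∈ J then (Fintype.piFinset S)ᶜ else univ).card =
      (N - b) ^ L * N ^ (Jᶜ : Finset I).card := by
    rw [Fintype.card_piFinset, ← prod_mul_prod_compl J]
    congr 1
    · rw [prod_congr rfl fun i hi => by rw [if_pos hi], prod_const, hJ, card_compl]
    · rw [prod_congr rfl fun i hi => by rw [if_neg (mem_compl.1 hi)], prod_const, card_univ]
  have htot : Fintype.card (I → K → X) = N ^ L * N ^ (Jᶜ : Finset I).card := by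
    rw [Fintype.card_fun, ← pow_add, card_compl, hJ, ← hN, Nat.add_sub_cancel']
    rw [← hJ]; exact card_le_univ J
  rw [hset, hcard, htot, mul_right_comm]
  refine Nat.mul_le_mul_right _ ?_
  rw [hL, pow_mul, pow_mul N, ← mul_pow, mul_comm]
  exact Nat.pow_le_pow_left hpow _

-- Union bound over `s` and at most `2 ^ (card X * card K)` boxes. The extra `+ 1` in `L` is what
-- leaves the factor `2 ^ card X`.
open Classical in
theorem card_not_hitsBoxes_mul_le [Fintype κ] [Fintype I] [Fintype K] [DecidableEq I] [DecidableEq K]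
    {D : ℕ} (hD : 0 < D) {idx : κ × Fin L → I}
    (hidx : Function.Injective idx)
    (hL : L = D ^ Fintype.card K * (Fintype.card X * (Fintype.card K + 1))) :
    (univ.filter fun ω : I → K → X => ¬ HitsBoxes D idx ω).card * 2 ^ Fintype.card X ≤
      Fintype.card κ * Fintype.card (I → K → X) := by
  have hsub : (univ.filter fun ω : I → K → X => ¬ HitsBoxes D idx ω) ⊆
      ((univ : Finset κ) ×ˢ (univ.filter fun S : K → Finset X =>
        ∀ c, Fintype.card X ≤ (S c).card * D)).biUnion fun q =>
          univ.filter fun ω : I → K → X => ∀ l, ¬ ∀ c, ω (idx (q.1, l)) c ∈ q.2 c := by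
    intro ω hω
    have := (mem_filter.1 hω).2
    unfold HitsBoxes at this
    push Not at this
    obtain ⟨s, S, hS, h⟩ := this
    refine mem_biUnion.2 ⟨(s, S), mem_product.2 ⟨mem_univ _, mem_filter.2 ⟨mem_univ _, hS⟩⟩,
      mem_filter.2 ⟨mem_univ _, fun l => ?_⟩⟩
    push Not
    exact h l
  have hbox : (univ.filter fun S : K → Finset X =>
      ∀ c, Fintype.card X ≤ (S c).card * D).card ≤ 2 ^ (Fintype.card X * Fintype.card K) := by
    refine (card_le_univ _).trans ?_
    rw [Fintype.card_fun, Fintype.card_finset, pow_mul]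
  refine Nat.le_of_mul_le_mul_right (c := 2 ^ (Fintype.card X * Fintype.card K)) ?_ (by positivity)
  rw [mul_assoc, ← pow_add,
    show Fintype.card X + Fintype.card X * Fintype.card K =
      Fintype.card X * (Fintype.card K + 1) by ring]
  refine (Nat.mul_le_mul_right _ ((card_le_card hsub).trans card_biUnion_le)).trans ?_
  rw [sum_mul]
  refine (sum_le_sum fun q hq => card_missing_box_mul_le hD hidx hL q.1 q.2
    (mem_filter.1 (mem_product.1 hq).2).2).trans ?_
  rw [sum_const, card_product, card_univ, smul_eq_mul]
  calc _ ≤ Fintype.card κ * 2 ^ (Fintype.card X * Fintype.card K) * Fintype.card (I → K → X) := by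
        gcongr
    _ = _ := by ring

open Classical in
/-- A random array hits all large boxes and has few gluing points with high probability. -/
theorem card_bad_arrays_mul_le [Fintype κ] [Fintype I] [Fintype K] [DecidableEq I] [DecidableEq K]
    [Nonempty X] {g D W E : ℕ} (hg : 0 < g) (hD : 0 < D) (hW1 : 1 ≤ W)
    {idx : κ × Fin L → I} (hidx : Function.Injective idx)
    (hL : L = D ^ Fintype.card K * (Fintype.card X * (Fintype.card K + 1)))
    (hW : Fintype.card I * Fintype.card K ^ 2 ≤ W * Fintype.card X)
    (hX : 2 * E * (D * (g * g * W ^ g)) ≤ Fintype.card X)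
    (hX' : 2 * E * Fintype.card κ ≤ Fintype.card X) :
    (univ.filter fun ω : I → K → X =>
      ¬ ((cyclePoints g ω).card * D ≤ Fintype.card X ∧ HitsBoxes D idx ω)).card * E ≤
        Fintype.card (I → K → X) := by
  set bad₁ := univ.filter fun ω : I → K → X => ¬ (cyclePoints g ω).card * D ≤ Fintype.card X
  set bad₂ := univ.filter fun ω : I → K → X => ¬ HitsBoxes D idx ω
  have hle : (univ.filter fun ω : I → K → X =>
      ¬ ((cyclePoints g ω).card * D ≤ Fintype.card X ∧ HitsBoxes D idx ω)).card ≤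
      bad₁.card + bad₂.card := by
    refine le_trans (card_le_card ?_) (card_union_le _ _)
    intro ω hω
    have := (mem_filter.1 hω).2
    rw [not_and_or] at this
    exact mem_union.2 (this.imp (fun h => mem_filter.2 ⟨mem_univ _, h⟩)
      fun h => mem_filter.2 ⟨mem_univ _, h⟩)
  -- Markov's inequality. Each of the two bad events receives half of the error `1 / E`.
  have h1 : bad₁.card * (2 * E) ≤ Fintype.card (I → K → X) := by
    have hpos : 0 < D * (g * g * W ^ g) := by positivity
    refine Nat.le_of_mul_le_mul_right (c := D * (g * g * W ^ g)) ?_ hpos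
    calc bad₁.card * (2 * E) * (D * (g * g * W ^ g))
        = bad₁.card * (2 * E * (D * (g * g * W ^ g))) := by ring
      _ ≤ bad₁.card * Fintype.card X := Nat.mul_le_mul_left _ hX
      _ = ∑ ω ∈ bad₁, Fintype.card X := by rw [sum_const, smul_eq_mul]
      _ ≤ ∑ ω ∈ bad₁, (cyclePoints g ω).card * D :=
        sum_le_sum fun ω hω => (not_le.1 (mem_filter.1 hω).2).le
      _ ≤ ∑ ω : I → K → X, (cyclePoints g ω).card * D :=
        sum_le_sum_of_subset (subset_univ _)
      _ = (∑ ω : I → K → X, (cyclePoints g ω).card) * D := (sum_mul _ _ _).symm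
      _ ≤ g * g * W ^ g * Fintype.card (I → K → X) * D :=
        Nat.mul_le_mul_right _ (sum_card_cyclePoints_le g hW1 hW)
      _ = _ := by ring
  have h2 : bad₂.card * (2 * E) ≤ Fintype.card (I → K → X) := by
    rcases isEmpty_or_nonempty κ with hκ | hκ
    · have : bad₂ = ∅ := filter_false_of_mem fun ω _ h => h fun s => (hκ.false s).elim
      simp [this]
    · have hpos : 0 < Fintype.card κ := Fintype.card_pos
      refine Nat.le_of_mul_le_mul_right (c := Fintype.card κ) ?_ hpos
      calc bad₂.card * (2 * E) * Fintype.card κ = bad₂.card * (2 * E * Fintype.card κ) := by ring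
        _ ≤ bad₂.card * 2 ^ Fintype.card X :=
          Nat.mul_le_mul_left _ (hX'.trans Nat.lt_two_pow_self.le)
        _ ≤ _ := card_not_hitsBoxes_mul_le hD hidx hL
        _ = _ := by ring
  nlinarith [Nat.mul_le_mul_right E hle]

end RandomArray

/-! ### Polynomially bounded functions -/

/-- `f` is bounded by a polynomial in the size of the argument. -/
def PolyBounded {α : Type*} (size : α → ℕ) (f : α → ℕ) : Prop :=
  ∃ C, ∀ x, f x ≤ (size x + 2) ^ C

namespace PolyBounded

variable {α : Type*} {size : α → ℕ} {f f' : α → ℕ}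

theorem mono (h : PolyBounded size f') (hf : ∀ x, f x ≤ f' x) : PolyBounded size f :=
  h.imp fun _ h x => (hf x).trans (h x)

theorem const (c : ℕ) : PolyBounded size fun _ => c :=
  ⟨c, fun x => Nat.lt_two_pow_self.le.trans (Nat.pow_le_pow_left (by omega) c)⟩

theorem self : PolyBounded size size := ⟨1, fun x => by rw [pow_one]; omega⟩

theorem mul (h : PolyBounded size f) (h' : PolyBounded size f') :
    PolyBounded size fun x => f x * f' x := by
  obtain ⟨C, h⟩ := h
  obtain ⟨C', h'⟩ := h'
  exact ⟨C + C', fun x => by rw [pow_add]; exact Nat.mul_le_mul (h x) (h' x)⟩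

theorem add (h : PolyBounded size f) (h' : PolyBounded size f') :
    PolyBounded size fun x => f x + f' x := by
  obtain ⟨C, h⟩ := h
  obtain ⟨C', h'⟩ := h'
  refine ⟨C + C' + 1, fun x => ?_⟩
  have h1 : (size x + 2) ^ C ≤ (size x + 2) ^ (C + C') :=
    Nat.pow_le_pow_right (by omega) (by omega)
  have h2 : (size x + 2) ^ C' ≤ (size x + 2) ^ (C + C') :=
    Nat.pow_le_pow_right (by omega) (by omega)
  have h3 : (size x + 2) ^ (C + C') * 2 ≤ (size x + 2) ^ (C + C' + 1) := by
    rw [pow_succ]; exact Nat.mul_le_mul_left _ (by omega)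
  have h4 := h x
  have h5 := h' x
  change f x + f' x ≤ _
  omega

theorem pow (h : PolyBounded size f) (k : ℕ) : PolyBounded size fun x => f x ^ k := by
  obtain ⟨C, h⟩ := h
  exact ⟨C * k, fun x => by rw [pow_mul]; exact Nat.pow_le_pow_left (h x) k⟩

theorem sum {ι : Type*} (s : Finset ι) {F : ι → α → ℕ} (h : ∀ i ∈ s, PolyBounded size (F i)) :
    PolyBounded size fun x => ∑ i ∈ s, F i x := by
  classical
  induction s using Finset.induction_on with
  | empty => exact const 0
  | insert i s hi ih =>
    simp only [Finset.sum_insert hi]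
    exact (h i (Finset.mem_insert_self i s)).add
      (ih fun j hj => h j (Finset.mem_insert_of_mem hj))

end PolyBounded

/-! ### Arrays drawn with fair coins -/

/-- The number with the binary digits `x 0, …, x (β - 1)`, the most significant one first. -/
def bitsToNat (x : ℕ → Bool) : ℕ → ℕ
  | 0 => 0
  | b + 1 => bitsToNat x b + bitsToNat x b + (x b).toNat

theorem bitsToNat_lt (x : ℕ → Bool) (β : ℕ) : bitsToNat x β < 2 ^ β := by
  induction β with
  | zero => simp [bitsToNat]
  | succ b ih =>
    have : (x b).toNat ≤ 1 := Bool.toNat_le _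
    rw [bitsToNat, pow_succ]
    omega

theorem bitsToNat_inj {x y : ℕ → Bool} {β : ℕ} (h : bitsToNat x β = bitsToNat y β) :
    ∀ b < β, x b = y b := by
  induction β with
  | zero => intro b hb; omega
  | succ k ih =>
    rw [bitsToNat, bitsToNat] at h
    have hx : (x k).toNat ≤ 1 := Bool.toNat_le _
    have hy : (y k).toNat ≤ 1 := Bool.toNat_le _
    intro b hb
    rcases Nat.lt_succ_iff_lt_or_eq.1 hb with hb | rfl
    · exact ih (by omega) b hb
    · have : (x b).toNat = (y b).toNat := by omega
      cases hx : x b <;> cases hy : y b <;> simp_all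

theorem bitsToNat_congr {x y : ℕ → Bool} {β : ℕ} (h : ∀ b < β, x b = y b) :
    bitsToNat x β = bitsToNat y β := by
  induction β with
  | zero => rfl
  | succ k ih =>
    rw [bitsToNat, bitsToNat, ih fun b hb => h b (by omega), h k (by omega)]

/-- An infinite sequence of bits that starts with the given ones. -/
def extendBits {T : ℕ} (ρ : Fin T → Bool) (i : ℕ) : Bool :=
  if h : i < T then ρ ⟨i, h⟩ else false

/-- Bit strings of length `β` correspond to the numbers below `2 ^ β`. -/
noncomputable def bitsEquiv (β : ℕ) : (Fin β → Bool) ≃ Fin (2 ^ β) :=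
  Equiv.ofBijective (fun x => ⟨bitsToNat (extendBits x) β, bitsToNat_lt _ _⟩) <| by
    rw [Fintype.bijective_iff_injective_and_card]
    refine ⟨fun x y h => ?_, by simp⟩
    funext b
    have := bitsToNat_inj (Fin.mk.inj_iff.1 h) b b.2
    simpa [extendBits] using this

/-- The array with entries below `2 ^ β` whose digits are read off a sequence of coin flips. -/
def arrayOfCoins (M A β : ℕ) (coins : ℕ → Bool) (i : Fin M) (a : Fin A) : Fin (2 ^ β) :=
  ⟨bitsToNat (fun b => coins (b + β * (a + A * i))) β, bitsToNat_lt _ _⟩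

/-- The array is uniformly distributed. -/
theorem card_arrayOfCoins {M A β T : ℕ} (hT : M * A * β ≤ T)
    (P : (Fin M → Fin A → Fin (2 ^ β)) → Prop) :
    Nat.card {ρ : Fin T → Bool // P (arrayOfCoins M A β (extendBits ρ))} *
      Nat.card (Fin M → Fin A → Fin (2 ^ β)) =
    Nat.card {ω : Fin M → Fin A → Fin (2 ^ β) // P ω} * 2 ^ T := by
  classical
  let pos : (Fin M × Fin A) × Fin β → Fin T := fun z =>
    Fin.castLE hT (finProdFinEquiv (finProdFinEquiv z.1, z.2))
  have hpos : Function.Injective pos := by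
    rintro ⟨z, b⟩ ⟨z', b'⟩ h
    have := finProdFinEquiv.injective (Fin.castLE_injective hT h)
    simp only [Prod.mk.injEq, EmbeddingLike.apply_eq_iff_eq] at this
    exact Prod.ext this.1 this.2
  let rest := {i : Fin T // ¬ i ∈ Set.range pos} → Bool
  -- The coins at the positions used by the array are regrouped into its entries; the other coins
  -- are independent of them and cancel in the count.
  let e : (Fin T → Bool) ≃ (Fin M → Fin A → Fin (2 ^ β)) × rest :=
    (Equiv.piEquivPiSubtypeProd (fun i => i ∈ Set.range pos) fun _ => Bool).trans
      (Equiv.prodCongr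
        (((Equiv.ofInjective pos hpos).symm.arrowCongr (Equiv.refl Bool)).trans
          ((Equiv.curry _ _ _).trans ((Equiv.curry _ _ _).trans
            (Equiv.piCongrRight fun _ => Equiv.piCongrRight fun _ => bitsEquiv β))))
        (Equiv.refl rest))
  have he : ∀ ρ, (e ρ).1 = arrayOfCoins M A β (extendBits ρ) := by
    intro ρ
    funext i a
    refine Fin.ext (bitsToNat_congr fun b hb => ?_)
    have hlt : b + β * (a + A * i) < T :=
      lt_of_lt_of_le (finProdFinEquiv (finProdFinEquiv (i, a), (⟨b, hb⟩ : Fin β))).2 hT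
    simp only [extendBits, hb, hlt, dif_pos]
    rfl
  have h1 : Nat.card {ρ : Fin T → Bool // P (arrayOfCoins M A β (extendBits ρ))} =
      Nat.card {ω : Fin M → Fin A → Fin (2 ^ β) // P ω} * Nat.card rest := by
    rw [← Nat.card_prod]
    refine Nat.card_congr ((e.subtypeEquiv (q := fun y => P y.1) fun ρ => by rw [he]).trans ?_)
    exact Equiv.prodSubtypeFstEquivSubtypeProd
  have h2 : 2 ^ T = Nat.card (Fin M → Fin A → Fin (2 ^ β)) * Nat.card rest := by
    rw [← Nat.card_prod, ← Nat.card_congr e]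
    simp
  rw [h1, h2]
  ring

/-- If all but a small fraction of the arrays make the program succeed, then it succeeds with high
probability. -/
theorem RAM.le_prob_of_arrayOfCoins {M A β T E : ℕ} (hE : 0 < E) (hT : M * A * β ≤ T)
    (p : RAM.Program) (input : List Bool) (S : Set (List Bool))
    (good : (Fin M → Fin A → Fin (2 ^ β)) → Prop)
    (hgood : Nat.card {ω // ¬ good ω} * E ≤ Nat.card (Fin M → Fin A → Fin (2 ^ β)))
    (h : ∀ ρ : Fin T → Bool, good (arrayOfCoins M A β (extendBits ρ)) →
      ∃ w ∈ S, RAM.HaltsWith p input (extendBits ρ) T w) :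
    1 - 1 / (E : ℝ) ≤ RAM.prob p input T S := by
  classical
  set O := Nat.card (Fin M → Fin A → Fin (2 ^ β)) with hO
  have hOpos : 0 < O := Nat.card_pos
  have hbad := card_arrayOfCoins hT fun ω => ¬ good ω
  set N := Nat.card {ρ : Fin T → Bool // ∃ w ∈ S, RAM.HaltsWith p input (extendBits ρ) T w}
  set Nb := Nat.card {ρ : Fin T → Bool // ¬ good (arrayOfCoins M A β (extendBits ρ))}
  have hle : 2 ^ T ≤ Nb + N := by
    have h1 : Nat.card {ρ : Fin T → Bool // good (arrayOfCoins M A β (extendBits ρ))} ≤ N :=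
      Nat.card_le_card_of_injective (fun ρ => ⟨ρ.1, h ρ.1 ρ.2⟩)
        fun ρ ρ' h => Subtype.ext (congrArg (fun x => x.1) h)
    have h2 : (2 : ℕ) ^ T = Nat.card (Fin T → Bool) := by simp
    have h3 : Nat.card (Fin T → Bool) =
        Nat.card {ρ : Fin T → Bool // good (arrayOfCoins M A β (extendBits ρ))} + Nb := by
      rw [← Nat.card_sum]
      exact Nat.card_congr (Equiv.sumCompl _).symm
    omega
  have hNb : Nb * E ≤ 2 ^ T := by
    refine Nat.le_of_mul_le_mul_right (c := O) ?_ hOpos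
    calc Nb * E * O = Nb * O * E := by ring
      _ = Nat.card {ω // ¬ good ω} * E * 2 ^ T := by rw [hbad]; ring
      _ ≤ O * 2 ^ T := Nat.mul_le_mul_right _ hgood
      _ = 2 ^ T * O := mul_comm _ _
  change 1 - 1 / (E : ℝ) ≤ (N : ℝ) / 2 ^ T
  have h2 : (0 : ℝ) < 2 ^ T := by positivity
  have hE' : (0 : ℝ) < E := by exact_mod_cast hE
  have h3 : (2 : ℝ) ^ T ≤ Nb + N := by exact_mod_cast hle
  have h4 : (Nb : ℝ) * E ≤ 2 ^ T := by exact_mod_cast hNb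
  have h5 : (Nb : ℝ) ≤ 2 ^ T / E := by rwa [le_div_iff₀ hE']
  rw [le_div_iff₀ h2, sub_mul, one_mul, one_div, ← div_eq_inv_mul]
  linarith

/-! ### Total correctness of random access machine programs -/

namespace RAM

/-- Started in `s`, the program halts within time `t` in a state that satisfies `Q`. -/
def Runs (p : Program) (t : ℕ) (s : State) (Q : State → Prop) : Prop :=
  ∃ n ≤ t, ∃ s', Exec p s n s' ∧ Q s'

@[simp] theorem State.set_reg (s : State) (x v i : ℕ) :
    (s.set x v).reg i = if i = x then v else s.reg i := by
  simp [State.set, Function.update_apply]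

@[simp] theorem State.set_mem (s : State) (x v : ℕ) : (s.set x v).mem = s.mem := rfl

@[simp] theorem State.set_out (s : State) (x v : ℕ) : (s.set x v).out = s.out := rfl

@[simp] theorem State.set_coins (s : State) (x v : ℕ) : (s.set x v).coins = s.coins := rfl

namespace Runs

variable {p q : Program} {t t' : ℕ} {s : State} {Q Q' : State → Prop}

theorem mono (h : Runs p t s Q) (ht : t ≤ t') (hQ : ∀ s, Q s → Q' s) : Runs p t' s Q' := by
  obtain ⟨n, hn, s', he, hs⟩ := h
  exact ⟨n, hn.trans ht, s', he, hQ _ hs⟩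

theorem imp (h : Runs p t s Q) (hQ : ∀ s, Q s → Q' s) : Runs p t s Q' := h.mono le_rfl hQ

theorem seq (h : Runs p t s fun s' => Runs q t' s' Q) : Runs (.seq p q) (t + t') s Q := by
  obtain ⟨n, hn, s₁, he, n', hn', s₂, he', hs⟩ := h
  exact ⟨n + n', by omega, s₂, .seq he he', hs⟩

theorem skip (h : Q s) : Runs .skip 1 s Q := ⟨1, le_rfl, _, .skip _, h⟩

theorem const {x c : ℕ} (h : Q (s.set x c)) : Runs (.const x c) 1 s Q :=
  ⟨1, le_rfl, _, .const _ _ _, h⟩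

theorem add {x y z : ℕ} (h : Q (s.set x (s.reg y + s.reg z))) : Runs (.add x y z) 1 s Q :=
  ⟨1, le_rfl, _, .add _ _ _ _, h⟩

theorem sub {x y z : ℕ} (h : Q (s.set x (s.reg y - s.reg z))) : Runs (.sub x y z) 1 s Q :=
  ⟨1, le_rfl, _, .sub _ _ _ _, h⟩

theorem load {x y : ℕ} (h : Q (s.set x (s.mem (s.reg y)))) : Runs (.load x y) 1 s Q :=
  ⟨1, le_rfl, _, .load _ _ _, h⟩

theorem store {x y : ℕ} (h : Q { s with mem := Function.update s.mem (s.reg x) (s.reg y) }) :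
    Runs (.store x y) 1 s Q :=
  ⟨1, le_rfl, _, .store _ _ _, h⟩

theorem flip {x : ℕ}
    (h : Q { s.set x (s.coins 0).toNat with coins := fun i => s.coins (i + 1) }) :
    Runs (.flip x) 1 s Q :=
  ⟨1, le_rfl, _, .flip _ _, h⟩

theorem write {x : ℕ} (h : Q { s with out := s.out ++ [decide (s.reg x ≠ 0)] }) :
    Runs (.write x) 1 s Q :=
  ⟨1, le_rfl, _, .write _ _, h⟩

theorem ite {x : ℕ} (h₁ : s.reg x ≠ 0 → Runs p t s Q) (h₂ : s.reg x = 0 → Runs q t s Q) :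
    Runs (.ite x p q) (t + 1) s Q := by
  by_cases h : s.reg x = 0
  · obtain ⟨n, hn, s', he, hs⟩ := h₂ h
    exact ⟨n + 1, by omega, s', .ite_false h he, hs⟩
  · obtain ⟨n, hn, s', he, hs⟩ := h₁ h
    exact ⟨n + 1, by omega, s', .ite_true h he, hs⟩

/-- A loop that runs `k` times, with an invariant. -/
theorem loop {x k : ℕ} (inv : ℕ → State → Prop) (h0 : inv 0 s)
    (hstep : ∀ i s, i < k → inv i s → s.reg x ≠ 0 ∧ Runs p t s (inv (i + 1)))
    (hend : ∀ s, inv k s → s.reg x = 0) : Runs (.loop x p) (k * (t + 1) + 1) s (inv k) := by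
  suffices h : ∀ d i s, i + d = k → inv i s → Runs (.loop x p) (d * (t + 1) + 1) s (inv k) from
    h k 0 s (by omega) h0
  intro d
  induction d with
  | zero =>
    rintro i s rfl hi
    exact ⟨1, by omega, s, by constructor; exact hend s hi, hi⟩
  | succ d ih =>
    intro i s hik hi
    obtain ⟨hx, n, hn, s₁, he, h₁⟩ := hstep i s (by omega) hi
    obtain ⟨n', hn', s₂, he', h₂⟩ := ih (i + 1) s₁ (by omega) h₁
    refine ⟨n + n' + 1, ?_, s₂, .loop_step hx he he', h₂⟩
    rw [Nat.succ_mul]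
    omega

end Runs

/-- The states `s` and `s'` differ at most in the registers from `b` on. -/
structure Frame (b : ℕ) (s s' : State) : Prop where
  reg : ∀ i < b, s'.reg i = s.reg i
  mem : s'.mem = s.mem
  out : s'.out = s.out
  coins : s'.coins = s.coins

namespace Frame

variable {b b' : ℕ} {s s₁ s₂ : State}

theorem refl (b : ℕ) (s : State) : Frame b s s := ⟨fun _ _ => rfl, rfl, rfl, rfl⟩

theorem trans (h : Frame b s s₁) (h' : Frame b s₁ s₂) : Frame b s s₂ :=
  ⟨fun i hi => (h'.reg i hi).trans (h.reg i hi), h'.mem.trans h.mem, h'.out.trans h.out,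
    h'.coins.trans h.coins⟩

theorem mono (h : Frame b' s s₁) (hb : b ≤ b') : Frame b s s₁ :=
  ⟨fun i hi => h.reg i (hi.trans_le hb), h.mem, h.out, h.coins⟩

theorem set (h : Frame b s s₁) {x : ℕ} (hx : b ≤ x) (v : ℕ) : Frame b s (s₁.set x v) :=
  ⟨fun i hi => by rw [State.set_reg, if_neg (by omega), h.reg i hi], h.mem, h.out, h.coins⟩

end Frame

/-! ### Functions that are computed in polynomial time -/

/-- A context: the arguments `x : α` of a function are represented by the first `width` registers
and the memory. -/
structure Ctx (α : Type) where
  /-- the number of registers in use -/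
  width : ℕ
  /-- the size in terms of which running times are measured -/
  size : α → ℕ
  /-- the state represents the argument -/
  holds : α → State → Prop
  stable : ∀ x s s', (∀ i < width, s'.reg i = s.reg i) → s'.mem = s.mem → holds x s → holds x s'

theorem Ctx.holds_of_frame {α : Type} {Γ : Ctx α} {x : α} {s s' : State} {b : ℕ}
    (h : Γ.holds x s) (hf : Frame b s s') (hb : Γ.width ≤ b) : Γ.holds x s' :=
  Γ.stable x s s' (fun i hi => hf.reg i (hi.trans_le hb)) hf.mem h

/-- Every state that represents `y` in `Γ'` represents `φ y` in `Γ`. -/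
structure Extends {α β : Type} (Γ' : Ctx β) (Γ : Ctx α) (φ : β → α) : Prop where
  width : Γ.width ≤ Γ'.width
  size : ∀ y, Γ'.size y = Γ.size (φ y)
  holds : ∀ y s, Γ'.holds y s → Γ.holds (φ y) s

/-- The function `f` can be computed in polynomial time into any free register. -/
def Comp {α : Type} (Γ : Ctx α) (f : α → ℕ) : Prop :=
  ∀ b ≥ Γ.width, ∃ p C, ∀ x s, Γ.holds x s →
    Runs p ((Γ.size x + 2) ^ C) s fun s' => Frame b s s' ∧ s'.reg b = f x

open Classical in
/-- The predicate `P` can be decided in polynomial time. -/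
def Decides {α : Type} (Γ : Ctx α) (P : α → Prop) : Prop :=
  Comp Γ fun x => if P x then 1 else 0

/-- All states that represent `x` have the memory `M x`. -/
def HasMem {α : Type} (Γ : Ctx α) (M : α → ℕ → ℕ) : Prop :=
  ∀ x s, Γ.holds x s → s.mem = M x

variable {α β : Type} {Γ : Ctx α} {Γ' : Ctx β} {φ : β → α} {f g h : α → ℕ} {P Q : α → Prop}

theorem HasMem.weaken {M : α → ℕ → ℕ} (hM : HasMem Γ M) (he : Extends Γ' Γ φ) :
    HasMem Γ' fun y => M (φ y) :=
  fun y s hs => hM _ s (he.holds y s hs)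

theorem _root_.PolyBounded.weaken (hf : PolyBounded Γ.size f) (he : Extends Γ' Γ φ) :
    PolyBounded Γ'.size fun y => f (φ y) := by
  obtain ⟨C, hC⟩ := hf
  exact ⟨C, fun y => by rw [he.size]; exact hC _⟩

namespace Comp

theorem of_polyBounded
    (H : ∀ b ≥ Γ.width, ∃ p T, PolyBounded Γ.size T ∧ ∀ x s, Γ.holds x s →
      Runs p (T x) s fun s' => Frame b s s' ∧ s'.reg b = f x) : Comp Γ f := by
  intro b hb
  obtain ⟨p, T, ⟨C, hC⟩, hp⟩ := H b hb
  exact ⟨p, C, fun x s hs => (hp x s hs).mono (hC x) fun _ h => h⟩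

theorem congr (hf : Comp Γ f) (hfg : ∀ x, g x = f x) : Comp Γ g := by
  obtain rfl : g = f := funext hfg
  exact hf

theorem weaken (hf : Comp Γ f) (he : Extends Γ' Γ φ) : Comp Γ' fun y => f (φ y) := by
  intro b hb
  obtain ⟨p, C, hp⟩ := hf b (he.width.trans hb)
  exact ⟨p, C, fun y s hs => by rw [he.size]; exact hp _ s (he.holds y s hs)⟩

theorem reg {i : ℕ} (hi : i < Γ.width) (hf : ∀ x s, Γ.holds x s → s.reg i = f x) : Comp Γ f := by
  refine of_polyBounded fun b hb => ⟨.seq (.const b 0) (.add b i b), fun _ => 1 + 1, .const _, ?_⟩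
  intro x s hs
  refine Runs.seq (.const (.add ?_))
  exact ⟨((Frame.refl b s).set le_rfl _).set le_rfl _, by
    rw [← hf x s hs]; simp [show i ≠ b by omega]⟩

theorem const (c : ℕ) : Comp Γ fun _ => c :=
  of_polyBounded fun b _ => ⟨.const b c, fun _ => 1, .const _, fun _ s _ =>
    .const ⟨(Frame.refl b s).set le_rfl _, by simp⟩⟩

/-- The operands go to the registers `b` and `b + 1`. The program for the second operand respects
`Frame (b + 1)`, so it preserves the first one. -/
theorem binary (op : ℕ → ℕ → ℕ) (instr : ℕ → ℕ → ℕ → Program)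
    (hop : ∀ x y z s Q, Q (s.set x (op (s.reg y) (s.reg z))) → Runs (instr x y z) 1 s Q)
    (hf : Comp Γ f) (hg : Comp Γ g) : Comp Γ fun x => op (f x) (g x) := by
  refine of_polyBounded fun b hb => ?_
  obtain ⟨p, C, hp⟩ := hf b hb
  obtain ⟨q, C', hq⟩ := hg (b + 1) (by omega)
  refine ⟨.seq p (.seq q (instr b b (b + 1))),
    fun x => (Γ.size x + 2) ^ C + ((Γ.size x + 2) ^ C' + 1),
    (PolyBounded.add ⟨C, fun _ => le_rfl⟩ (.add ⟨C', fun _ => le_rfl⟩ (.const 1))), ?_⟩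
  intro x s hs
  refine .seq ((hp x s hs).imp ?_)
  rintro s₁ ⟨hf₁, h₁⟩
  refine .seq ((hq x s₁ (Γ.holds_of_frame hs hf₁ hb)).imp ?_)
  rintro s₂ ⟨hf₂, h₂⟩
  refine hop _ _ _ _ _ ⟨(hf₁.trans (hf₂.mono (by omega))).set le_rfl _, ?_⟩
  rw [State.set_reg, if_pos rfl, hf₂.reg b (by omega), h₁, h₂]

theorem add (hf : Comp Γ f) (hg : Comp Γ g) : Comp Γ fun x => f x + g x :=
  binary (· + ·) .add (fun _ _ _ _ _ h => .add h) hf hg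

theorem sub (hf : Comp Γ f) (hg : Comp Γ g) : Comp Γ fun x => f x - g x :=
  binary (· - ·) .sub (fun _ _ _ _ _ h => .sub h) hf hg

theorem load {M : α → ℕ → ℕ} (hM : HasMem Γ M) (hf : Comp Γ f) : Comp Γ fun x => M x (f x) := by
  refine of_polyBounded fun b hb => ?_
  obtain ⟨p, C, hp⟩ := hf b hb
  refine ⟨.seq p (.load b b), fun x => (Γ.size x + 2) ^ C + 1,
    (PolyBounded.add ⟨C, fun _ => le_rfl⟩ (.const 1)), ?_⟩
  intro x s hs
  refine .seq ((hp x s hs).imp ?_)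
  rintro s₁ ⟨hf₁, h₁⟩
  refine .load ⟨hf₁.set le_rfl _, ?_⟩
  rw [State.set_reg, if_pos rfl, hM x s₁ (Γ.holds_of_frame hs hf₁ hb), h₁]

open Classical in
theorem ite (hP : Decides Γ P) (hf : Comp Γ f) (hg : Comp Γ g) :
    Comp Γ fun x => if P x then f x else g x := by
  refine of_polyBounded fun b hb => ?_
  obtain ⟨c, C, hc⟩ := hP b hb
  obtain ⟨p, C', hp⟩ := hf b hb
  obtain ⟨q, C'', hq⟩ := hg b hb
  refine ⟨.seq c (.ite b p q),
    fun x => (Γ.size x + 2) ^ C + ((Γ.size x + 2) ^ C' + (Γ.size x + 2) ^ C'' + 1),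
    (PolyBounded.add ⟨C, fun _ => le_rfl⟩ (.add (.add ⟨C', fun _ => le_rfl⟩
      ⟨C'', fun _ => le_rfl⟩) (.const 1))), ?_⟩
  intro x s hs
  refine .seq ((hc x s hs).imp ?_)
  rintro s₁ ⟨hf₁, h₁⟩
  replace h₁ : s₁.reg b = if P x then 1 else 0 := h₁
  have hs₁ := Γ.holds_of_frame hs hf₁ hb
  refine .ite (fun hne => ?_) fun heq => ?_
  · have hPx : P x := by
      by_contra h
      rw [h₁, if_neg h] at hne
      exact hne rfl
    refine (hp x s₁ hs₁).mono (by omega) ?_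
    rintro s₂ ⟨hf₂, h₂⟩
    exact ⟨hf₁.trans hf₂, by rw [h₂, if_pos hPx]⟩
  · have hPx : ¬ P x := by
      intro h
      rw [h₁, if_pos h] at heq
      omega
    refine (hq x s₁ hs₁).mono (by omega) ?_
    rintro s₂ ⟨hf₂, h₂⟩
    exact ⟨hf₁.trans hf₂, by rw [h₂, if_neg hPx]⟩

/-- Functions defined by recursion with a polynomially bounded number of steps. -/
theorem natRec {F : α → ℕ → ℕ → ℕ} (hf : Comp Γ f) (hg : Comp Γ g) (hgb : PolyBounded Γ.size g)
    (hF : ∀ {β : Type} (Γ' : Ctx β) (φ : β → α) (i acc : β → ℕ), Extends Γ' Γ φ → Comp Γ' i →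
      Comp Γ' acc → Comp Γ' fun y => F (φ y) (i y) (acc y)) :
    Comp Γ fun x => Nat.rec (motive := fun _ => ℕ) (f x) (F x) (g x) := by
  refine of_polyBounded fun b hb => ?_
  obtain ⟨p, C, hp⟩ := hf b hb
  obtain ⟨q, C', hq⟩ := hg (b + 2) (by omega)
  -- Register `b` holds the accumulator, `b + 1` the index and `b + 2` the number of remaining
  -- rounds. The body puts its result into `b + 3`, and `b + 4` is scratch space.
  let Γ' : Ctx (α × ℕ × ℕ) :=
    { width := b + 3
      size := fun y => Γ.size y.1
      holds := fun y s => Γ.holds y.1 s ∧ s.reg b = y.2.2 ∧ s.reg (b + 1) = y.2.1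
      stable := by
        rintro y s s' hr hm ⟨h₁, h₂, h₃⟩
        exact ⟨Γ.stable _ s s' (fun i hi => hr i (by omega)) hm h₁,
          (hr _ (by omega)).trans h₂, (hr _ (by omega)).trans h₃⟩ }
  obtain ⟨r, C'', hr⟩ := hF Γ' Prod.fst (fun y => y.2.1) (fun y => y.2.2)
    ⟨show Γ.width ≤ b + 3 by omega, fun _ => rfl, fun _ _ h => h.1⟩
    (.reg (i := b + 1) (show b + 1 < b + 3 by omega) fun _ _ h => h.2.2)
    (.reg (i := b) (show b < b + 3 by omega) fun _ _ h => h.2.1) (b + 3) le_rfl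
  refine ⟨.seq p (.seq q (.seq (.const (b + 1) 0) (.loop (b + 2) (.seq r (.seq (.const (b + 4) 0)
      (.seq (.add b (b + 3) (b + 4)) (.seq (.const (b + 4) 1)
        (.seq (.add (b + 1) (b + 1) (b + 4)) (.sub (b + 2) (b + 2) (b + 4)))))))))),
    fun x => (Γ.size x + 2) ^ C + ((Γ.size x + 2) ^ C' +
      (1 + (g x * ((Γ.size x + 2) ^ C'' + (1 + (1 + (1 + (1 + 1)))) + 1) + 1))),
    (PolyBounded.add ⟨C, fun _ => le_rfl⟩ (.add ⟨C', fun _ => le_rfl⟩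
      (.add (.const 1) (.add (.mul hgb (.add (.add ⟨C'', fun _ => le_rfl⟩ (.const _)) (.const 1)))
        (.const 1))))), ?_⟩
  intro x s hs
  refine .seq ((hp x s hs).imp ?_)
  rintro s₁ ⟨hf₁, h₁⟩
  refine .seq ((hq x s₁ (Γ.holds_of_frame hs hf₁ hb)).imp ?_)
  rintro s₂ ⟨hf₂, h₂⟩
  refine .seq (.const ?_)
  let inv : ℕ → State → Prop := fun i s' => Frame b s s' ∧
    s'.reg b = Nat.rec (motive := fun _ => ℕ) (f x) (F x) i ∧ s'.reg (b + 1) = i ∧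
      s'.reg (b + 2) = g x - i
  refine (Runs.loop inv ?_ ?_ ?_).imp fun s' h => ⟨h.1, h.2.1⟩
  · refine ⟨(hf₁.trans (hf₂.mono (by omega))).set (by omega) _, ?_, by simp, ?_⟩
    · simp [hf₂.reg b (by omega), h₁]
    · simp [h₂]
  · rintro i s₃ hi ⟨hf₃, h₃, h₃', h₃''⟩
    refine ⟨by omega, .seq ((hr (x, i, s₃.reg b) s₃
      ⟨Γ.holds_of_frame hs hf₃ hb, rfl, h₃'⟩).imp ?_)⟩
    rintro s₄ ⟨hf₄, h₄⟩
    refine .seq (.const (.seq (.add (.seq (.const (.seq (.add (.sub ?_))))))))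
    refine ⟨((((((hf₃.trans (hf₄.mono (by omega))).set (by omega) _).set (by omega) _).set
      (by omega) _).set (by omega) _).set (by omega) _), ?_, ?_, ?_⟩
    · simp [h₄, h₃]
    · simp [hf₄.reg (b + 1) (by omega), h₃']
    · simp [hf₄.reg (b + 2) (by omega), h₃'']
      omega
  · rintro s' ⟨-, -, -, h⟩
    omega

theorem mul (hf : Comp Γ f) (hg : Comp Γ g) (hgb : PolyBounded Γ.size g) :
    Comp Γ fun x => f x * g x := by
  refine congr (natRec (f := fun _ => 0) (F := fun x _ acc => acc + f x) (.const 0) hg hgb ?_) ?_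
  · intro β Γ' φ i acc he _ hacc
    exact hacc.add (hf.weaken he)
  · intro x
    induction g x with
    | zero => rfl
    | succ k ih => rw [Nat.mul_succ, ih]

theorem pow (hf : Comp Γ f) (hfb : PolyBounded Γ.size f) (k : ℕ) : Comp Γ fun x => f x ^ k := by
  induction k with
  | zero => exact .const 1
  | succ k ih => exact ih.mul hf hfb

theorem sum {ι : Type*} (s : Finset ι) {F : ι → α → ℕ} (hF : ∀ i ∈ s, Comp Γ (F i)) :
    Comp Γ fun x => ∑ i ∈ s, F i x := by
  classical
  induction s using Finset.induction_on with
  | empty => exact .const 0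
  | insert i s hi ih =>
    simp only [Finset.sum_insert hi]
    exact (hF i (Finset.mem_insert_self i s)).add
      (ih fun j hj => hF j (Finset.mem_insert_of_mem hj))

end Comp

/-! ### Decidable predicates and bounded search -/

namespace Decides

theorem congr (hP : Decides Γ P) (h : ∀ x, Q x ↔ P x) : Decides Γ Q := by
  obtain rfl : Q = P := funext fun x => propext (h x)
  exact hP

theorem weaken (hP : Decides Γ P) (he : Extends Γ' Γ φ) : Decides Γ' fun y => P (φ y) :=
  Comp.weaken hP he

theorem const (p : Prop) : Decides Γ fun _ => p :=
  Comp.const _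

theorem not (hP : Decides Γ P) : Decides Γ fun x => ¬ P x := by
  refine Comp.congr (Comp.ite hP (.const 0) (.const 1)) fun x => ?_
  by_cases h : P x <;> simp [h]

theorem and (hP : Decides Γ P) (hQ : Decides Γ Q) : Decides Γ fun x => P x ∧ Q x := by
  refine Comp.congr (Comp.ite hP hQ (.const 0)) fun x => ?_
  by_cases h : P x <;> by_cases h' : Q x <;> simp [h, h']

theorem or (hP : Decides Γ P) (hQ : Decides Γ Q) : Decides Γ fun x => P x ∨ Q x :=
  (hP.not.and hQ.not).not.congr fun x => by tauto

theorem lt (hf : Comp Γ f) (hg : Comp Γ g) : Decides Γ fun x => f x < g x := by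
  -- With truncated subtraction, `1 - (1 - d)` is the indicator of `d ≠ 0`.
  refine Comp.congr ((Comp.const 1).sub ((Comp.const 1).sub (hg.sub hf))) fun x => ?_
  split_ifs <;> omega

theorem eq (hf : Comp Γ f) (hg : Comp Γ g) : Decides Γ fun x => f x = g x :=
  ((lt hf hg).or (lt hg hf)).not.congr fun x => by omega

theorem exists_mem {ι : Type*} (s : Finset ι) {P : ι → α → Prop} (hP : ∀ i ∈ s, Decides Γ (P i)) :
    Decides Γ fun x => ∃ i ∈ s, P i x := by
  classical
  induction s using Finset.induction_on with
  | empty => simpa using const False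
  | insert i s hi ih =>
    simp only [Finset.exists_mem_insert]
    exact (hP i (Finset.mem_insert_self i s)).or
      (ih fun j hj => hP j (Finset.mem_insert_of_mem hj))

theorem exists_fintype {ι : Type*} [Fintype ι] {P : ι → α → Prop} (hP : ∀ i, Decides Γ (P i)) :
    Decides Γ fun x => ∃ i, P i x :=
  (exists_mem Finset.univ fun i _ => hP i).congr fun x => by simp

theorem forall_fintype {ι : Type*} [Fintype ι] {P : ι → α → Prop} (hP : ∀ i, Decides Γ (P i)) :
    Decides Γ fun x => ∀ i, P i x :=
  (exists_fintype fun i => (hP i).not).not.congr fun x => by simp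

/-- Bounded search. -/
theorem exists_lt {P : α → ℕ → Prop} (hg : Comp Γ g) (hgb : PolyBounded Γ.size g)
    (hP : ∀ {β : Type} (Γ' : Ctx β) (φ : β → α) (i : β → ℕ), Extends Γ' Γ φ → Comp Γ' i →
      Decides Γ' fun y => P (φ y) (i y)) :
    Decides Γ fun x => ∃ i < g x, P x i := by
  classical
  refine Comp.congr (.natRec (f := fun _ => 0) (F := fun x i acc => if P x i then 1 else acc)
    (.const 0) hg hgb ?_) ?_
  · intro β Γ' φ i acc he hi hacc
    exact (Comp.ite (hP Γ' φ i he hi) (.const 1) hacc).congr fun y => by split_ifs <;> rfl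
  · intro x
    beta_reduce
    induction g x with
    | zero => simp
    | succ k ih =>
      have : (∃ i < k + 1, P x i) ↔ P x k ∨ ∃ i < k, P x i := by
        constructor
        · rintro ⟨i, hi, h⟩
          rcases Nat.lt_succ_iff_lt_or_eq.1 hi with hi | rfl
          · exact Or.inr ⟨i, hi, h⟩
          · exact Or.inl h
        · rintro (h | ⟨i, hi, h⟩)
          · exact ⟨k, by omega, h⟩
          · exact ⟨i, by omega, h⟩
      simp only [this]
      change _ = if P x k then 1 else _
      rw [← ih]
      by_cases h : P x k <;> simp [h]

/-- Bounded search for vectors of fixed length. -/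
theorem exists_vector_lt (k : ℕ) {α : Type} {Γ : Ctx α} {g : α → ℕ} {P : α → (Fin k → ℕ) → Prop}
    (hg : Comp Γ g) (hgb : PolyBounded Γ.size g)
    (hP : ∀ {β : Type} (Γ' : Ctx β) (φ : β → α) (v : Fin k → β → ℕ), Extends Γ' Γ φ →
      (∀ c, Comp Γ' (v c)) → Decides Γ' fun y => P (φ y) fun c => v c y) :
    Decides Γ fun x => ∃ v : Fin k → ℕ, (∀ c, v c < g x) ∧ P x v := by
  induction k generalizing α with
  | zero =>
    refine (hP Γ id (fun c => c.elim0) ⟨le_rfl, fun _ => rfl, fun _ _ h => h⟩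
      fun c => c.elim0).congr fun x => ?_
    constructor
    · rintro ⟨v, -, h⟩
      exact (congrArg (P x) (Subsingleton.elim _ v)).mpr h
    · exact fun h => ⟨_, fun c => c.elim0, h⟩
  | succ k ih =>
    refine (exists_lt (P := fun x i => ∃ v : Fin k → ℕ, (∀ c, v c < g x) ∧ P x (Fin.cons i v))
      hg hgb ?_).congr ?_
    · intro β Γ₁ φ₁ i he₁ hi
      refine ih (hg.weaken he₁) (hgb.weaken he₁) (P := fun y v => P (φ₁ y) (Fin.cons (i y) v)) ?_
      intro γ Γ₂ φ₂ v he₂ hv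
      refine (hP Γ₂ (fun z => φ₁ (φ₂ z)) (Fin.cons (fun z => i (φ₂ z)) v)
        ⟨he₁.width.trans he₂.width, fun z => by rw [he₂.size, he₁.size],
          fun z s h => he₁.holds _ _ (he₂.holds _ _ h)⟩ ?_).congr ?_
      · intro c
        refine Fin.cases ?_ (fun c => ?_) c
        · exact hi.weaken he₂
        · exact hv c
      · intro z
        have : (fun c => (Fin.cons (fun z => i (φ₂ z)) v : Fin (k + 1) → γ → ℕ) c z) =
            (Fin.cons (i (φ₂ z)) fun c => v c z : Fin (k + 1) → ℕ) := by
          funext c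
          refine Fin.cases ?_ (fun c => ?_) c <;> simp
        rw [this]
    · intro x
      constructor
      · rintro ⟨v, hv, h⟩
        exact ⟨v 0, hv 0, Fin.tail v, fun c => hv _, by rwa [Fin.cons_self_tail]⟩
      · rintro ⟨i, hi, v, hv, h⟩
        exact ⟨Fin.cons i v, fun c => Fin.cases (by simpa using hi) (fun c => by simpa using hv c) c,
          h⟩

end Decides

/-! ### Programs that write -/

/-- The word `w x` can be appended to the output in polynomial time. -/
def Writes (Γ : Ctx α) (w : α → List Bool) : Prop :=
  ∃ p C, ∀ x s, Γ.holds x s → Runs p ((Γ.size x + 2) ^ C) s fun s' =>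
    (∀ i < Γ.width, s'.reg i = s.reg i) ∧ s'.mem = s.mem ∧ s'.out = s.out ++ w x

namespace Writes

variable {v w : α → List Bool}

theorem of_polyBounded (H : ∃ p T, PolyBounded Γ.size T ∧ ∀ x s, Γ.holds x s →
    Runs p (T x) s fun s' =>
      (∀ i < Γ.width, s'.reg i = s.reg i) ∧ s'.mem = s.mem ∧ s'.out = s.out ++ w x) :
    Writes Γ w := by
  obtain ⟨p, T, ⟨C, hC⟩, hp⟩ := H
  exact ⟨p, C, fun x s hs => (hp x s hs).mono (hC x) fun _ h => h⟩

theorem nil : Writes Γ fun _ => [] :=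
  of_polyBounded ⟨.skip, fun _ => 1, .const 1, fun x s _ => .skip ⟨fun _ _ => rfl, rfl, by simp⟩⟩

theorem append (hv : Writes Γ v) (hw : Writes Γ w) : Writes Γ fun x => v x ++ w x := by
  obtain ⟨p, C, hp⟩ := hv
  obtain ⟨q, C', hq⟩ := hw
  refine of_polyBounded ⟨.seq p q, fun x => (Γ.size x + 2) ^ C + (Γ.size x + 2) ^ C',
    (PolyBounded.add ⟨C, fun _ => le_rfl⟩ ⟨C', fun _ => le_rfl⟩), ?_⟩
  intro x s hs
  refine .seq ((hp x s hs).imp ?_)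
  rintro s₁ ⟨h₁, h₂, h₃⟩
  refine (hq x s₁ (Γ.stable x s s₁ h₁ h₂ hs)).imp ?_
  rintro s₂ ⟨h₁', h₂', h₃'⟩
  exact ⟨fun i hi => (h₁' i hi).trans (h₁ i hi), h₂'.trans h₂, by
    rw [h₃', h₃, List.append_assoc]⟩

open Classical in
theorem bit (hP : Decides Γ P) : Writes Γ fun x => [decide (P x)] := by
  obtain ⟨p, C, hp⟩ := hP Γ.width le_rfl
  refine of_polyBounded ⟨.seq p (.write Γ.width), fun x => (Γ.size x + 2) ^ C + 1,
    (PolyBounded.add ⟨C, fun _ => le_rfl⟩ (.const 1)), ?_⟩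
  intro x s hs
  refine .seq ((hp x s hs).imp ?_)
  rintro s₁ ⟨hf, h⟩
  refine .write ⟨hf.reg, hf.mem, ?_⟩
  rw [hf.out, h]
  by_cases hx : P x <;> simp [hx]

theorem flatten_ofFn {k : ℕ} {w : Fin k → α → List Bool} (hw : ∀ i, Writes Γ (w i)) :
    Writes Γ fun x => (List.ofFn fun i => w i x).flatten := by
  induction k with
  | zero => simpa using nil
  | succ k ih =>
    simp only [List.ofFn_succ, List.flatten_cons]
    exact (hw 0).append (ih fun i => hw i.succ)

theorem flatten_range {w : α → ℕ → List Bool} (hg : Comp Γ g) (hgb : PolyBounded Γ.size g)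
    (hw : ∀ {β : Type} (Γ' : Ctx β) (φ : β → α) (i : β → ℕ), Extends Γ' Γ φ → Comp Γ' i →
      Writes Γ' fun y => w (φ y) (i y)) :
    Writes Γ fun x => ((List.range (g x)).map (w x)).flatten := by
  set b := Γ.width with hb
  obtain ⟨q, C, hq⟩ := hg (b + 1) (by omega)
  let Γ' : Ctx (α × ℕ) :=
    { width := b + 2
      size := fun y => Γ.size y.1
      holds := fun y s => Γ.holds y.1 s ∧ s.reg b = y.2
      stable := by
        rintro y s s' hr hm ⟨h₁, h₂⟩
        exact ⟨Γ.stable _ s s' (fun i hi => hr i (by omega)) hm h₁, (hr _ (by omega)).trans h₂⟩ }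
  obtain ⟨r, C', hr⟩ := hw Γ' Prod.fst (fun y => y.2)
    ⟨show Γ.width ≤ b + 2 by omega, fun _ => rfl, fun _ _ h => h.1⟩
    (.reg (i := b) (show b < b + 2 by omega) fun _ _ h => h.2)
  refine of_polyBounded ⟨.seq q (.seq (.const b 0) (.loop (b + 1) (.seq r (.seq (.const (b + 2) 1)
      (.seq (.add b b (b + 2)) (.sub (b + 1) (b + 1) (b + 2))))))),
    fun x => (Γ.size x + 2) ^ C +
      (1 + (g x * ((Γ.size x + 2) ^ C' + (1 + (1 + 1)) + 1) + 1)),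
    (PolyBounded.add ⟨C, fun _ => le_rfl⟩
      (.add (.const 1) (.add (.mul hgb (.add (.add ⟨C', fun _ => le_rfl⟩ (.const _)) (.const 1)))
        (.const 1)))), ?_⟩
  intro x s hs
  refine .seq ((hq x s hs).imp ?_)
  rintro s₁ ⟨hf₁, h₁⟩
  refine .seq (.const ?_)
  let inv : ℕ → State → Prop := fun i s' => (∀ j < b, s'.reg j = s.reg j) ∧ s'.mem = s.mem ∧
    s'.out = s.out ++ ((List.range i).map (w x)).flatten ∧ s'.reg b = i ∧ s'.reg (b + 1) = g x - i
  refine (Runs.loop inv ?_ ?_ ?_).imp fun s' h => ⟨h.1, h.2.1, h.2.2.1⟩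
  · refine ⟨fun j hj => ?_, hf₁.mem, by simp [hf₁.out], by simp, by simp [h₁]⟩
    rw [State.set_reg, if_neg (by omega), hf₁.reg j (by omega)]
  · rintro i s₂ hi ⟨h₂, h₂m, h₂o, h₂', h₂''⟩
    refine ⟨by omega, .seq ((hr (x, i) s₂
      ⟨Γ.stable x s s₂ (fun j hj => h₂ j hj) h₂m hs, h₂'⟩).imp ?_)⟩
    rintro s₃ ⟨h₃, h₃m, h₃o⟩
    refine .seq (.const (.seq (.add (.sub ?_))))
    refine ⟨fun j hj => ?_, h₃m.trans h₂m, ?_, ?_, ?_⟩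
    · simp [show j ≠ b by omega, show j ≠ b + 1 by omega, show j ≠ b + 2 by omega]
      rw [h₃ j (show j < b + 2 by omega), h₂ j hj]
    · simp [h₃o, h₂o, List.range_succ]
    · simp [h₃ b (show b < b + 2 by omega), h₂']
    · simp [h₃ (b + 1) (show b + 1 < b + 2 by omega), h₂'']
      omega
  · rintro s' ⟨-, -, -, -, h⟩
    omega

end Writes

end RAM

/-! ### Positions in the encoding of a structure -/

theorem List.getD_flatten_ofFn {β : Type*} (d : β) {k : ℕ} (F : Fin k → List β) (R : Fin k) {j : ℕ}
    (hj : j < (F R).length) :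
    (List.ofFn F).flatten.getD
      ((∑ R' ∈ Finset.univ.filter (· < R), (F R').length) + j) d = (F R).getD j d := by
  induction k with
  | zero => exact R.elim0
  | succ k ih =>
    rw [List.ofFn_succ, List.flatten_cons]
    refine Fin.cases (fun hj => ?_) (fun R hj => ?_) R hj
    · rw [Finset.filter_false_of_mem fun R' _ => by simp, Finset.sum_empty, zero_add,
        List.getD_append _ _ _ _ hj]
    · rw [Finset.sum_filter, Fin.sum_univ_succ, if_pos (Fin.succ_pos R)]
      simp only [Fin.succ_lt_succ_iff]
      rw [List.getD_append_right _ _ _ _ (by omega), ← ih (fun i => F i.succ) R hj,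
        Finset.sum_filter]
      congr 1
      omega

namespace RelStructure

variable {τ : Signature}

/-- The position of the table of `R`, counted from the beginning of the first table. -/
def tableOffset (τ : Signature) (R : τ.Symbol) (m : ℕ) : ℕ :=
  ∑ R' ∈ Finset.univ.filter (· < R), m ^ τ.arity R'

/-- The length of the encoding of a structure with `m` elements. -/
def codeLength (τ : Signature) (m : ℕ) : ℕ := m + 1 + ∑ R : τ.Symbol, m ^ τ.arity R

variable {m : ℕ} (B : RelStructure τ (Fin m))

@[simp] theorem length_table (R : τ.Symbol) : (B.table R).length = m ^ τ.arity R := by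
  simp [table]

theorem encode_getD_of_lt {i : ℕ} (hi : i < m) : B.encode.getD i false = true := by
  rw [encode, List.append_assoc, List.getD_append _ _ _ _ (by simpa using hi)]
  simp [hi]

theorem encode_getD_self : B.encode.getD m false = false := by
  rw [encode, List.append_assoc, List.getD_append_right _ _ _ _ (by simp)]
  simp

theorem encode_getD_table (R : τ.Symbol) {j : ℕ} (hj : j < m ^ τ.arity R) :
    B.encode.getD (m + 1 + tableOffset τ R m + j) false = true ↔
      finFunctionFinEquiv.symm ⟨j, hj⟩ ∈ B.rel R := by
  rw [encode, List.getD_append_right _ _ _ _ (by simp; omega)]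
  have h := List.getD_flatten_ofFn false (fun R => B.table R) R (j := j) (by simpa using hj)
  simp only [length_table] at h
  have h' : m + 1 + tableOffset τ R m + j - (List.replicate m true ++ [false]).length =
      (∑ R' ∈ Finset.univ.filter (· < R), m ^ τ.arity R') + j := by
    simp [tableOffset]; omega
  rw [h', h, List.getD_eq_getElem _ _ (by simpa using hj)]
  simp [table]

/-- Ensures that the coin flips, which are stored from address `codeLength` on, do not overwrite the
tables. -/
theorem table_position_lt (R : τ.Symbol) {j : ℕ} (hj : j < m ^ τ.arity R) :
    m + 1 + tableOffset τ R m + j < codeLength τ m := by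
  have h : tableOffset τ R m + m ^ τ.arity R ≤ ∑ R : τ.Symbol, m ^ τ.arity R := by
    rw [tableOffset, add_comm, ← Finset.sum_insert (f := fun R => m ^ τ.arity R) (by simp)]
    exact Finset.sum_le_sum_of_subset (Finset.subset_univ _)
  rw [codeLength]
  omega

end RelStructure

namespace RAM

/-! ### Functions of the size of the input -/

/-- The number `m x` is available and is the size in terms of which time is measured. -/
structure Sized {α : Type} (Γ : Ctx α) (m : α → ℕ) : Prop where
  size : ∀ x, Γ.size x = m x
  comp : Comp Γ m

theorem Sized.weaken {α β : Type} {Γ : Ctx α} {Γ' : Ctx β} {φ : β → α} {m : α → ℕ}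
    (h : Sized Γ m) (he : Extends Γ' Γ φ) : Sized Γ' fun y => m (φ y) :=
  ⟨fun y => (he.size y).trans (h.size _), h.comp.weaken he⟩

/-- A polynomially bounded function that can be computed in time polynomial in its argument. -/
structure PolyTime (F : ℕ → ℕ) : Prop where
  bounded : PolyBounded id F
  comp : ∀ {α : Type} {Γ : Ctx α} {m : α → ℕ}, Sized Γ m → Comp Γ fun x => F (m x)

namespace PolyTime

variable {F G : ℕ → ℕ}

theorem polyBounded (hF : PolyTime F) {α : Type} {Γ : Ctx α} {m : α → ℕ} (hm : Sized Γ m) :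
    PolyBounded Γ.size fun x => F (m x) := by
  obtain ⟨C, hC⟩ := hF.bounded
  exact ⟨C, fun x => by rw [hm.size]; exact hC _⟩

theorem id : PolyTime fun m => m := ⟨.self, fun h => h.comp⟩

theorem const (c : ℕ) : PolyTime fun _ => c := ⟨.const c, fun _ => .const c⟩

theorem add (hF : PolyTime F) (hG : PolyTime G) : PolyTime fun m => F m + G m :=
  ⟨hF.bounded.add hG.bounded, fun h => (hF.comp h).add (hG.comp h)⟩

theorem mul (hF : PolyTime F) (hG : PolyTime G) : PolyTime fun m => F m * G m :=
  ⟨hF.bounded.mul hG.bounded, fun h => (hF.comp h).mul (hG.comp h) (hG.polyBounded h)⟩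

theorem pow (hF : PolyTime F) (k : ℕ) : PolyTime fun m => F m ^ k :=
  ⟨hF.bounded.pow k, fun h => (hF.comp h).pow (hF.polyBounded h) k⟩

theorem sum {ι : Type*} (s : Finset ι) {F : ι → ℕ → ℕ} (hF : ∀ i ∈ s, PolyTime (F i)) :
    PolyTime fun m => ∑ i ∈ s, F i m :=
  ⟨.sum s fun i hi => (hF i hi).bounded, fun h => .sum s fun i hi => (hF i hi).comp h⟩

end PolyTime

/-- The power `2 ^ i`, for `i ≤ k`. -/
theorem natRec_ite_double (i k : ℕ) :
    Nat.rec (motive := fun _ => ℕ) 1 (fun b acc => if b < i then acc + acc else acc) k =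
      2 ^ min i k := by
  induction k with
  | zero => simp
  | succ k ih =>
    change (if k < i then _ else _) = _
    rw [ih]
    split_ifs with h
    · rw [min_eq_right h.le, min_eq_right (by omega : k + 1 ≤ i), pow_succ]; ring
    · rw [min_eq_left (by omega), min_eq_left (by omega)]

/-- Truncating the exponent lets a loop of `m x + 2` rounds suffice, whatever the size of `f x`. The
truncation is harmless for the exponents that matter, by `clog_le`. -/
theorem Sized.comp_two_pow_min {α : Type} {Γ : Ctx α} {m f : α → ℕ} (hm : Sized Γ m)
    (hf : Comp Γ f) : Comp Γ fun x => 2 ^ min (f x) (m x + 2) := by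
  classical
  refine Comp.congr (.natRec (f := fun _ => 1)
    (F := fun x b acc => if b < f x then acc + acc else acc) (.const 1)
    (hm.comp.add (.const 2)) ((PolyTime.id.add (.const 2)).polyBounded hm) ?_) fun x =>
      (natRec_ite_double _ _).symm
  intro β Γ' φ b acc he hb hacc
  exact (Comp.ite (.lt hb (hf.weaken he)) (hacc.add hacc) hacc).congr fun y => by
    split_ifs <;> rfl

theorem clog_le (m : ℕ) : Nat.clog 2 (m + 2) ≤ m + 2 :=
  Nat.clog_le_of_le_pow Nat.lt_two_pow_self.le

theorem natRec_clog (m : ℕ) :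
    Nat.rec (motive := fun _ => ℕ) 0
      (fun i acc => if 2 ^ min i (m + 2) < m + 2 then acc + 1 else acc) (m + 2) =
        Nat.clog 2 (m + 2) := by
  suffices h : ∀ k ≤ m + 2, Nat.rec (motive := fun _ => ℕ) 0
      (fun i acc => if 2 ^ min i (m + 2) < m + 2 then acc + 1 else acc) k =
        min k (Nat.clog 2 (m + 2)) by
    rw [h _ le_rfl, min_eq_right (clog_le m)]
  intro k hk
  induction k with
  | zero => simp
  | succ k ih =>
    change (if _ then _ else _) = _
    rw [ih (by omega), min_eq_left (by omega : k ≤ m + 2)]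
    have hiff : 2 ^ k < m + 2 ↔ k < Nat.clog 2 (m + 2) :=
      (Nat.lt_clog_iff_pow_lt (by norm_num)).symm
    split_ifs with h
    · have := hiff.1 h
      rw [min_eq_left this.le, min_eq_left this]
    · have := not_lt.1 (mt hiff.2 h)
      rw [min_eq_right this, min_eq_right (this.trans (Nat.le_succ k))]

theorem PolyTime.clog : PolyTime fun m => Nat.clog 2 (m + 2) := by
  classical
  refine ⟨(PolyBounded.self.add (.const 2)).mono clog_le, ?_⟩
  intro α Γ m hm
  refine Comp.congr (.natRec (f := fun _ => 0)
    (F := fun x i acc => if 2 ^ min i (m x + 2) < m x + 2 then acc + 1 else acc) (.const 0)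
    (hm.comp.add (.const 2)) ((PolyTime.id.add (.const 2)).polyBounded hm) ?_) fun x =>
      (natRec_clog (m x)).symm
  intro β Γ' φ i acc he hi hacc
  have hm' := hm.weaken he
  exact (Comp.ite (.lt (hm'.comp_two_pow_min hi) (hm'.comp.add (.const 2)))
    (hacc.add (.const 1)) hacc).congr fun y => by split_ifs <;> rfl

theorem PolyTime.two_pow_clog : PolyTime fun m => 2 ^ Nat.clog 2 (m + 2) := by
  refine ⟨((PolyBounded.const 2).mul (PolyBounded.self.add (.const 2))).mono fun m => ?_, ?_⟩
  · have h := Nat.pow_pred_clog_lt_self (b := 2) (by norm_num) (show 1 < m + 2 by omega)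
    have h0 : 0 < Nat.clog 2 (m + 2) := Nat.clog_pos (by norm_num) (by omega)
    obtain ⟨e, he⟩ : ∃ e, Nat.clog 2 (m + 2) = e + 1 := ⟨_, (Nat.succ_pred_eq_of_pos h0).symm⟩
    rw [he, Nat.pred_succ] at h
    rw [he, pow_succ]
    simp only [id_eq]
    omega
  · intro α Γ m hm
    exact (hm.comp_two_pow_min (PolyTime.clog.comp hm)).congr fun x => by
      rw [min_eq_left (clog_le _)]

/-! ### Programs with random access to the input and to coin flips -/

/-- An input structure and a sequence of coin flips. -/
structure Input (τ : Signature) : Type where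
  /-- the number of elements of the structure -/
  card : ℕ
  /-- the structure -/
  struct : RelStructure τ (Fin card)
  /-- the coin flips -/
  coins : ℕ → Bool

variable {τ : Signature}

/-- The memory after the outcomes of `T` coin flips have been stored behind the input. -/
noncomputable def Input.memory (T : ℕ → ℕ) (x : Input τ) (a : ℕ) : ℕ :=
  if RelStructure.codeLength τ x.card ≤ a ∧ a < RelStructure.codeLength τ x.card + T x.card then
    (x.coins (a - RelStructure.codeLength τ x.card)).toNat
  else (x.struct.encode.getD a false).toNat

theorem Input.memory_coin {T : ℕ → ℕ} (x : Input τ) {i : ℕ} (hi : i < T x.card) :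
    x.memory T (RelStructure.codeLength τ x.card + i) = (x.coins i).toNat := by
  rw [Input.memory, if_pos (by omega), Nat.add_sub_cancel_left]

theorem Input.memory_table {T : ℕ → ℕ} (x : Input τ) (R : τ.Symbol) {j : ℕ}
    (hj : j < x.card ^ τ.arity R) :
    x.memory T (x.card + 1 + RelStructure.tableOffset τ R x.card + j) ≠ 0 ↔
      finFunctionFinEquiv.symm ⟨j, hj⟩ ∈ x.struct.rel R := by
  rw [Input.memory, if_neg (by
      have := RelStructure.table_position_lt (τ := τ) R hj
      omega), ← x.struct.encode_getD_table R hj]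
  cases x.struct.encode.getD _ _ <;> simp

theorem PolyTime.codeLength : PolyTime (RelStructure.codeLength τ) :=
  (PolyTime.id.add (.const 1)).add (.sum _ fun _ _ => PolyTime.id.pow _)

theorem PolyTime.tableOffset (R : τ.Symbol) : PolyTime (RelStructure.tableOffset τ R) :=
  .sum _ fun _ _ => PolyTime.id.pow _

/-- Counts the elements of the input structure. -/
theorem runs_count {m : ℕ} (B : RelStructure τ (Fin m)) (coins : ℕ → Bool) :
    Runs (.seq (.const 0 0) (.seq (.load 1 0) (.loop 1 (.seq (.const 2 1) (.seq (.add 0 0 2)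
      (.load 1 0)))))) (1 + (1 + (m * (1 + (1 + 1) + 1) + 1))) (init B.encode coins)
      fun s => s.reg 0 = m ∧ s.mem = (init B.encode coins).mem ∧ s.out = [] ∧ s.coins = coins := by
  refine .seq (.const (.seq (.load ?_)))
  refine (Runs.loop (fun i s => s.reg 0 = i ∧ s.reg 1 = (B.encode.getD i false).toNat ∧
    s.mem = (init B.encode coins).mem ∧ s.out = [] ∧ s.coins = coins) ?_ ?_ ?_).imp ?_
  · exact ⟨by simp, by simp [init], rfl, rfl, rfl⟩
  · rintro i s hi ⟨h0, h1, hm, ho, hc⟩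
    refine ⟨by rw [h1, B.encode_getD_of_lt hi]; simp, ?_⟩
    refine .seq (.const (.seq (.add (.load ?_))))
    refine ⟨by simp [h0], by simp [h0, hm, init], hm, ho, hc⟩
  · rintro s ⟨-, h1, -⟩
    rw [h1, B.encode_getD_self]
    rfl
  · rintro s ⟨h0, -, hm, ho, hc⟩
    exact ⟨h0, hm, ho, hc⟩

/-- Stores coin flips in the memory from address `reg 2` on. -/
theorem runs_fill {T a : ℕ} {s : State} (h1 : s.reg 1 = T) (h2 : s.reg 2 = a) :
    Runs (.loop 1 (.seq (.flip 3) (.seq (.store 2 3) (.seq (.const 3 1) (.seq (.add 2 2 3)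
      (.sub 1 1 3)))))) (T * (1 + (1 + (1 + (1 + 1))) + 1) + 1) s fun s' =>
        s'.reg 0 = s.reg 0 ∧ s'.out = s.out ∧ ∀ b, s'.mem b =
          if a ≤ b ∧ b < a + T then (s.coins (b - a)).toNat else s.mem b := by
  refine (Runs.loop (fun i s' => s'.reg 0 = s.reg 0 ∧ s'.out = s.out ∧ (∀ b, s'.mem b =
    if a ≤ b ∧ b < a + i then (s.coins (b - a)).toNat else s.mem b) ∧ s'.reg 1 = T - i ∧
      s'.reg 2 = a + i ∧ ∀ j, s'.coins j = s.coins (i + j)) ?_ ?_ ?_).imp ?_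
  · refine ⟨rfl, rfl, fun b => ?_, h1, h2, fun j => by rw [zero_add]⟩
    rw [if_neg (by omega)]
  · rintro i s' hi ⟨h0, ho, hm, h1, h2, hc⟩
    refine ⟨by omega, .seq (.flip (.seq (.store (.seq (.const (.seq (.add (.sub ?_)))))))) ⟩
    refine ⟨by simpa using h0, ho, fun b => ?_, ?_, ?_, fun j => ?_⟩
    · simp only [State.set_mem, State.set_reg, Function.update_apply, hm, h2]
      simp only [Nat.reduceEqDiff, if_false, if_true]
      by_cases hb : b = a + i
      · subst hb
        rw [if_pos rfl, if_pos (by omega), hc, Nat.add_sub_cancel_left, add_zero]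
      · rw [if_neg hb]
        exact if_congr (by omega) rfl rfl
    · simp [h1]; omega
    · simp [h2]; omega
    · simp only [State.set_coins, hc]
      congr 1
      omega
  · rintro s' ⟨-, -, -, h, -⟩
    omega
  · rintro s' ⟨h0, ho, hm, -⟩
    exact ⟨h0, ho, hm⟩

/-- A word that can be written with access to the input and to stored coin flips can be produced
from scratch. -/
theorem exists_program_of_writes {T : ℕ → ℕ} (hT : PolyTime T) (w : Input τ → List Bool)
    (hw : ∀ Γ : Ctx (Input τ), Sized Γ Input.card → HasMem Γ (Input.memory T) → Writes Γ w) :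
    ∃ (p : Program) (time : Polynomial ℕ), ∀ m, T m ≤ time.eval m ∧
      ∀ (B : RelStructure τ (Fin m)) (coins : ℕ → Bool),
        HaltsWith p B.encode coins (time.eval m) (w ⟨m, B, coins⟩) := by
  let Γ₀ : Ctx (Input τ) :=
    { width := 1
      size := Input.card
      holds := fun x s => s.reg 0 = x.card
      stable := fun x s s' hr _ h => (hr 0 one_pos).trans h }
  have h₀ : Sized Γ₀ Input.card := ⟨fun _ => rfl, .reg (i := 0) one_pos fun _ _ h => h⟩
  let Γ₁ : Ctx (Input τ) :=
    { width := 1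
      size := Input.card
      holds := fun x s => s.reg 0 = x.card ∧ s.mem = x.memory T
      stable := fun x s s' hr hm h => ⟨(hr 0 one_pos).trans h.1, hm.trans h.2⟩ }
  have h₁ : Sized Γ₁ Input.card := ⟨fun _ => rfl, .reg (i := 0) one_pos fun _ _ h => h.1⟩
  -- The number of coins goes to register 1 and the address behind the input to register 2, where
  -- the filling loop expects them.
  obtain ⟨p, C, hp⟩ := hT.comp h₀ 1 le_rfl
  obtain ⟨q, C', hq⟩ := (PolyTime.codeLength (τ := τ)).comp h₀ 2 one_le_two
  obtain ⟨r, C'', hr⟩ := hw Γ₁ h₁ fun _ _ h => h.2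
  -- The summand `T m` makes the time bound at least the number of coins, so that the strings
  -- counted by `prob` determine the whole array.
  obtain ⟨K, hK⟩ : PolyBounded id fun m => T m +
      (1 + (1 + (m * (1 + (1 + 1) + 1) + 1)) + ((m + 2) ^ C + ((m + 2) ^ C' +
        ((T m * (1 + (1 + (1 + (1 + 1))) + 1) + 1) + (m + 2) ^ C'')))) :=
    hT.bounded.add (((PolyBounded.const 1).add ((PolyBounded.const 1).add
      ((PolyBounded.self.mul (.const _)).add (.const 1)))).add
      (.add ⟨C, fun _ => le_rfl⟩ (.add ⟨C', fun _ => le_rfl⟩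
        (.add ((hT.bounded.mul (.const _)).add (.const 1)) ⟨C'', fun _ => le_rfl⟩))))
  refine ⟨.seq (.seq (.const 0 0) (.seq (.load 1 0) (.loop 1 (.seq (.const 2 1) (.seq (.add 0 0 2)
    (.load 1 0)))))) (.seq p (.seq q (.seq (.loop 1 (.seq (.flip 3) (.seq (.store 2 3)
      (.seq (.const 3 1) (.seq (.add 2 2 3) (.sub 1 1 3)))))) r))),
    (Polynomial.X + Polynomial.C 2) ^ K, fun m => ?_⟩
  have heval : ((Polynomial.X + Polynomial.C 2 : Polynomial ℕ) ^ K).eval m = (m + 2) ^ K := by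
    simp
  have hKm := hK m
  simp only [id_eq] at hKm
  rw [heval]
  refine ⟨le_trans (Nat.le_add_right _ _) hKm, fun B coins => ?_⟩
  have key : Runs (.seq (.seq (.const 0 0) (.seq (.load 1 0) (.loop 1 (.seq (.const 2 1)
    (.seq (.add 0 0 2) (.load 1 0)))))) (.seq p (.seq q (.seq (.loop 1 (.seq (.flip 3)
      (.seq (.store 2 3) (.seq (.const 3 1) (.seq (.add 2 2 3) (.sub 1 1 3)))))) r))))
      (1 + (1 + (m * (1 + (1 + 1) + 1) + 1)) + ((m + 2) ^ C + ((m + 2) ^ C' +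
        ((T m * (1 + (1 + (1 + (1 + 1))) + 1) + 1) + (m + 2) ^ C'')))) (init B.encode coins)
      fun s => s.out = w ⟨m, B, coins⟩ := by
    refine .seq ((runs_count B coins).imp ?_)
    rintro s₁ ⟨hs₁, hm₁, ho₁, hc₁⟩
    refine .seq ((hp ⟨m, B, coins⟩ s₁ hs₁).imp ?_)
    rintro s₂ ⟨hf₂, hs₂⟩
    have hs₂' : s₂.reg 0 = m := (hf₂.reg 0 one_pos).trans hs₁
    refine .seq ((hq ⟨m, B, coins⟩ s₂ hs₂').imp ?_)
    rintro s₃ ⟨hf₃, hs₃⟩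
    refine .seq ((runs_fill ((hf₃.reg 1 one_lt_two).trans hs₂) hs₃).imp ?_)
    rintro s₄ ⟨hs₄, ho₄, hm₄⟩
    refine (hr ⟨m, B, coins⟩ s₄ ⟨hs₄.trans ((hf₃.reg 0 two_pos).trans hs₂'), ?_⟩).imp ?_
    · funext b
      rw [hm₄, hf₃.coins, hf₂.coins, hc₁, hf₃.mem, hf₂.mem, hm₁]
      rfl
    · rintro s₅ ⟨-, -, ho₅⟩
      rw [ho₅, ho₄, hf₃.out, hf₂.out, ho₁, List.nil_append]
  obtain ⟨n, hn, s, he, hs⟩ := key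
  exact ⟨n, by omega, s, he, hs⟩

/-- The encoding of a structure can be written if its relations are decidable in polynomial time. -/
theorem Writes.encode {α : Type} {Γ : Ctx α} {N : α → ℕ} (hN : Comp Γ N)
    (hNb : PolyBounded Γ.size N) (C : ∀ x, RelStructure τ (Fin (N x)))
    (P : τ.Symbol → α → ℕ → Prop)
    (hP : ∀ R x (j : Fin (N x ^ τ.arity R)), finFunctionFinEquiv.symm j ∈ (C x).rel R ↔ P R x j)
    (hdec : ∀ R {β : Type} (Γ' : Ctx β) (φ : β → α) (j : β → ℕ), Extends Γ' Γ φ → Comp Γ' j →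
      Decides Γ' fun y => P R (φ y) (j y)) :
    Writes Γ fun x => (C x).encode := by
  classical
  have h1 : Writes Γ fun x => ((List.range (N x)).map fun _ => [decide True]).flatten :=
    .flatten_range hN hNb fun Γ' _ _ _ _ => by
      convert Writes.bit (Decides.const (Γ := Γ') True)
  have h2 : Writes Γ fun _ => [decide False] := by
    convert Writes.bit (Decides.const (Γ := Γ) False)
  have h3 : Writes Γ fun x => (List.ofFn fun R : τ.Symbol =>
      ((List.range (N x ^ τ.arity R)).map fun j => [decide (P R x j)]).flatten).flatten :=
    .flatten_ofFn fun R => .flatten_range (hN.pow hNb _) (hNb.pow _) fun Γ' φ j he hj => by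
      convert Writes.bit (hdec R Γ' φ j he hj)
  convert (h1.append h2).append h3 using 2 with x
  rw [RelStructure.encode]
  have hr : ∀ n : ℕ, List.replicate n true =
      ((List.range n).map fun _ => [decide True]).flatten := by
    intro n
    induction n with
    | zero => rfl
    | succ n ih => rw [List.range_succ, List.replicate_succ', ih]; simp
  have ht : ∀ R, (C x).table R =
      ((List.range (N x ^ τ.arity R)).map fun j => [decide (P R x j)]).flatten := by
    intro R
    rw [RelStructure.table]
    have : ∀ l : List ℕ, (l.map fun j => [decide (P R x j)]).flatten =
        l.map fun j => decide (P R x j) := by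
      intro l
      induction l with
      | nil => rfl
      | cons a l ih => simp [ih]
    rw [this]
    refine List.ext_getElem (by simp) fun i hi hi' => ?_
    simp [hP]
  rw [hr]
  simp only [ht]
  rfl

end RAM

/-! ### The randomized construction -/

namespace Signature

variable (τ : Signature)

/-- The maximal arity of a symbol. -/
def maxArity : ℕ := Finset.univ.sup τ.arity

theorem arity_le (R : τ.Symbol) : τ.arity R ≤ τ.maxArity :=
  Finset.le_sup (f := τ.arity) (Finset.mem_univ R)

/-- The number of codes for patterns over `m` vertices. -/
def numCodes (m : ℕ) : ℕ := (m + 1) ^ τ.maxArity * τ.numSymbols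

/-- The number of binary digits of the elements of a fibre. -/
def digits (C m : ℕ) : ℕ := Nat.clog 2 (m + 2) * C

/-- The size of the fibres. -/
def fibre (C m : ℕ) : ℕ := 2 ^ digits C m

/-- The number of random rows for every pattern. -/
def rowsPerPattern (C m : ℕ) : ℕ :=
  (8 * (m + 1)) ^ τ.maxArity * (fibre C m * (τ.maxArity + 1))

/-- The total number of random rows. -/
def numRows (C m : ℕ) : ℕ := τ.numCodes m * τ.rowsPerPattern C m

/-- The number of coin flips. -/
def numCoins (C m : ℕ) : ℕ := τ.numRows C m * τ.maxArity * digits C m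

/-- A bound for the average degree of the random rows. -/
def degreeBound (m : ℕ) : ℕ :=
  τ.numCodes m * (8 * (m + 1)) ^ τ.maxArity * (τ.maxArity + 1) * τ.maxArity ^ 2 + 1

/-- A lower bound for the size of the fibres. -/
def fibreBound (g c m : ℕ) : ℕ :=
  2 * (m + 2) ^ c * (8 * (m + 1) * (g * g * τ.degreeBound m ^ g)) +
    2 * (m + 2) ^ c * τ.numCodes m + (m + 1)

/-- The base is `m + 1` because powers of `m` are not monotone in the exponent when `m = 0`. -/
theorem pow_arity_le (R : τ.Symbol) (m : ℕ) : m ^ τ.arity R ≤ (m + 1) ^ τ.maxArity :=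
  (Nat.pow_le_pow_left (Nat.le_succ m) _).trans
    (Nat.pow_le_pow_right (Nat.succ_pos m) (τ.arity_le R))

/-- The row with number `l` for a given pattern. -/
def rowIndex (C m : ℕ) (p : τ.Pattern m × Fin (τ.rowsPerPattern C m)) : Fin (τ.numRows C m) :=
  finProdFinEquiv (finProdFinEquiv
    (Fin.castLE (τ.pow_arity_le p.1.1 m) (finFunctionFinEquiv p.1.2), p.1.1), p.2)

theorem rowIndex_injective (C m : ℕ) : Function.Injective (τ.rowIndex C m) := by
  rintro ⟨⟨R, t⟩, l⟩ ⟨⟨R', t'⟩, l'⟩ h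
  obtain ⟨h1, rfl⟩ := Prod.mk.inj (finProdFinEquiv.injective h)
  obtain ⟨h2, rfl⟩ := Prod.mk.inj (finProdFinEquiv.injective h1)
  obtain rfl := finFunctionFinEquiv.injective (Fin.castLE_injective _ h2)
  rfl

theorem rowIndex_val (C m : ℕ) (R : τ.Symbol) (t : Fin (τ.arity R) → Fin m)
    (l : Fin (τ.rowsPerPattern C m)) :
    (τ.rowIndex C m (⟨R, t⟩, l) : ℕ) =
      l + τ.rowsPerPattern C m * (R + τ.numSymbols * ∑ c, (t c : ℕ) * m ^ (c : ℕ)) := by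
  simp [rowIndex, finProdFinEquiv]

theorem card_pattern_le (m : ℕ) : Fintype.card (τ.Pattern m) ≤ τ.numCodes m := by
  rw [Fintype.card_sigma, numCodes]
  refine (Finset.sum_le_card_nsmul _ _ ((m + 1) ^ τ.maxArity) fun R _ => ?_).trans ?_
  · simpa using τ.pow_arity_le R m
  · rw [Finset.card_univ, Fintype.card_fin, smul_eq_mul, mul_comm]

end Signature

/-! ### The parameters are polynomially bounded and computable -/

namespace RAM

open Signature

variable {τ : Signature}

theorem PolyTime.numCodes : PolyTime τ.numCodes :=
  ((PolyTime.id.add (.const 1)).pow _).mul (.const _)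

theorem PolyTime.digits (C : ℕ) : PolyTime (digits C) := PolyTime.clog.mul (.const C)

theorem PolyTime.fibre (C : ℕ) : PolyTime (fibre C) := by
  have : Signature.fibre C = fun m => (2 ^ Nat.clog 2 (m + 2)) ^ C := by
    funext m
    rw [Signature.fibre, Signature.digits, pow_mul]
  rw [this]
  exact PolyTime.two_pow_clog.pow C

theorem PolyTime.rowsPerPattern (C : ℕ) : PolyTime (τ.rowsPerPattern C) :=
  (((PolyTime.const 8).mul (PolyTime.id.add (.const 1))).pow _).mul
    ((PolyTime.fibre C).mul (.const _))

theorem PolyTime.numRows (C : ℕ) : PolyTime (τ.numRows C) :=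
  PolyTime.numCodes.mul (PolyTime.rowsPerPattern C)

theorem PolyTime.numCoins (C : ℕ) : PolyTime (τ.numCoins C) :=
  ((PolyTime.numRows C).mul (.const _)).mul (PolyTime.digits C)

theorem PolyTime.fibreBound (g c : ℕ) : PolyTime (τ.fibreBound g c) := by
  have h1 : PolyTime fun m => 8 * (m + 1) := (PolyTime.const 8).mul (PolyTime.id.add (.const 1))
  have h2 : PolyTime fun m => 2 * (m + 2) ^ c :=
    (PolyTime.const 2).mul ((PolyTime.id.add (.const 2)).pow c)
  have h3 : PolyTime τ.degreeBound :=
    ((((PolyTime.numCodes.mul (h1.pow _)).mul (.const _)).mul (.const _)).add (.const 1))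
  exact ((h2.mul (h1.mul ((PolyTime.const _).mul (h3.pow g)))).add (h2.mul .numCodes)).add
    (PolyTime.id.add (.const 1))

/-- There is no circularity: the number of rows is proportional to the fibre size, but their average
degree, and hence `fibreBound`, is a polynomial in `m` alone. The fibre size is at least `(m + 2) ^
C`, so a suitable exponent dominates it. -/
theorem exists_fibreBound_le (g c : ℕ) : ∃ C, ∀ m, τ.fibreBound g c m ≤ fibre C m := by
  obtain ⟨C, hC⟩ := (PolyTime.fibreBound (τ := τ) g c).bounded
  refine ⟨C, fun m => (hC m).trans ?_⟩
  rw [Signature.fibre, Signature.digits, pow_mul]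
  exact Nat.pow_le_pow_left (Nat.le_pow_clog (by norm_num) _) C

/-- The random array that belongs to an input. -/
def Input.array (C : ℕ) (x : Input τ) :
    Fin (τ.numRows C x.card) → Fin τ.maxArity → Fin (fibre C x.card) :=
  arrayOfCoins (τ.numRows C x.card) τ.maxArity (Signature.digits C x.card) x.coins

/-- The structure that is constructed from an input. -/
def Input.output (g C : ℕ) (x : Input τ) : RelStructure τ (Fin (x.card * fibre C x.card)) :=
  RelStructure.sparseLift g τ.arity_le (τ.rowIndex C x.card) (x.array C) x.struct

/-- The entry of the random array in row `i` and column `a`, computed from the memory. -/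
noncomputable def Input.cell (C : ℕ) (x : Input τ) (i a : ℕ) : ℕ :=
  Nat.rec (motive := fun _ => ℕ) 0 (fun b acc => acc + acc +
    x.memory (τ.numCoins C) (RelStructure.codeLength τ x.card +
      (b + (a + i * τ.maxArity) * Signature.digits C x.card))) (Signature.digits C x.card)

theorem Input.cell_eq (C : ℕ) (x : Input τ) (i : Fin (τ.numRows C x.card))
    (a : Fin τ.maxArity) : x.cell C i a = x.array C i a := by
  change Nat.rec (motive := fun _ => ℕ) _ _ _ = bitsToNat _ _
  suffices h : ∀ k ≤ Signature.digits C x.card,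
      Nat.rec (motive := fun _ => ℕ) 0 (fun b acc => acc + acc +
        x.memory (τ.numCoins C) (RelStructure.codeLength τ x.card +
          (b + (a + i * τ.maxArity) * Signature.digits C x.card))) k =
      bitsToNat (fun b => x.coins (b + Signature.digits C x.card *
        (a + τ.maxArity * i))) k from h _ le_rfl
  intro k hk
  induction k with
  | zero => rfl
  | succ k ih =>
    -- The position of a digit is the mixed radix number of row, column and digit, so it inherits
    -- its bound from `finProdFinEquiv`.
    have hlt : k + Signature.digits C x.card * (a + τ.maxArity * i) < τ.numCoins C x.card :=
      (finProdFinEquiv (finProdFinEquiv (i, a), (⟨k, hk⟩ : Fin (Signature.digits C x.card)))).2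
    rw [bitsToNat, ← ih (by omega), ← x.memory_coin hlt, mul_comm τ.maxArity,
      mul_comm (Signature.digits C x.card)]

/-! ### Evaluating the lift from the stored input and coins -/

section Expressions

variable {α β : Type} {Γ : Ctx α} {X : α → Input τ} {C : ℕ}

/-- The context represents the size of an input and has stored the input and the coin flips. -/
structure Represents (C : ℕ) (Γ : Ctx α) (X : α → Input τ) : Prop where
  sized : Sized Γ fun x => (X x).card
  mem : HasMem Γ fun x => (X x).memory (τ.numCoins C)

theorem Represents.weaken {Γ' : Ctx β} {φ : β → α} (h : Represents C Γ X)
    (he : Extends Γ' Γ φ) : Represents C Γ' fun y => X (φ y) :=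
  ⟨h.sized.weaken he, h.mem.weaken he⟩

theorem comp_cell (h : Represents C Γ X) {i a : α → ℕ} (hi : Comp Γ i) (ha : Comp Γ a) :
    Comp Γ fun x => (X x).cell C (i x) (a x) := by
  refine .natRec (F := fun x b acc => acc + acc + (X x).memory (τ.numCoins C)
    (RelStructure.codeLength τ (X x).card + (b + (a x + i x * τ.maxArity) *
      Signature.digits C (X x).card))) (.const 0)
    ((PolyTime.digits C).comp h.sized) ((PolyTime.digits C).polyBounded h.sized) ?_
  intro β Γ' φ b acc he hb hacc
  have h' := h.weaken he
  exact (hacc.add hacc).add (.load h'.mem ((PolyTime.codeLength.comp h'.sized).add (hb.add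
    (((ha.weaken he).add ((hi.weaken he).mul (.const _) (.const _))).mul
      ((PolyTime.digits C).comp h'.sized) ((PolyTime.digits C).polyBounded h'.sized)))))

/-- The row with number `i` lies on a short cycle of the random array. -/
def Input.OnCycle (g C : ℕ) (x : Input τ) (i : ℕ) : Prop :=
  ∃ j ∈ Finset.range g, 2 ≤ j ∧ ∃ ab : (Fin j → Fin τ.maxArity) × (Fin j → Fin τ.maxArity),
    (∀ l, ab.1 l ≠ ab.2 l) ∧ ∃ r : Fin j → ℕ, (∀ l, r l < τ.numRows C x.card) ∧
      ((∀ l l', l = l' ∨ ¬ r l = r l') ∧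
        (∀ l, x.cell C (r l) (ab.2 l) = x.cell C (r (finRotate j l)) (ab.1 (finRotate j l))) ∧
          ∃ l, r l = i)

theorem Input.onCycle_iff {g C : ℕ} {x : Input τ} (i : Fin (τ.numRows C x.card)) :
    x.OnCycle g C i ↔ OnShortCycle g (x.array C) i := by
  constructor
  · rintro ⟨j, hj, hj2, ⟨a, b⟩, hab, r, hr, hinj, hglue, l, hl⟩
    refine ⟨j, hj2, Finset.mem_range.1 hj, fun l => ⟨r l, hr l⟩, a, b, ⟨?_, hab, ?_⟩, l,
      Fin.ext hl⟩
    · intro l l' h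
      exact (hinj l l').resolve_right fun hne => hne (Fin.mk.inj_iff.1 h)
    · intro l
      have := hglue l
      rw [x.cell_eq C ⟨r l, hr l⟩, x.cell_eq C ⟨r (finRotate j l), hr _⟩] at this
      exact Fin.ext this
  · rintro ⟨j, hj2, hj, r, a, b, hc, l, rfl⟩
    refine ⟨j, Finset.mem_range.2 hj, hj2, (a, b), hc.ne, fun l => r l, fun l => (r l).2, ?_, ?_,
      l, rfl⟩
    · intro l l'
      by_cases h : l = l'
      · exact Or.inl h
      · exact Or.inr fun h' => h (hc.injective (Fin.ext h'))
    · intro l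
      rw [x.cell_eq, x.cell_eq]
      exact congrArg Fin.val (hc.glue l)

/-- Brute force: for fixed `g` and `τ` there are constantly many lengths and choices of columns, and
at most `numRows ^ j` sequences of rows with `j < g`. -/
theorem decides_onCycle (g : ℕ) (h : Represents C Γ X) {i : α → ℕ} (hi : Comp Γ i) :
    Decides Γ fun x => (X x).OnCycle g C (i x) := by
  refine .exists_mem _ fun j _ => (Decides.const _).and (.exists_fintype fun ab =>
    (Decides.const _).and (.exists_vector_lt j ((PolyTime.numRows C).comp h.sized)
      ((PolyTime.numRows C).polyBounded h.sized)
      (P := fun x r => (∀ l l', l = l' ∨ ¬ r l = r l') ∧ (∀ l, (X x).cell C (r l) (ab.2 l) =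
        (X x).cell C (r (finRotate j l)) (ab.1 (finRotate j l))) ∧ ∃ l, r l = i x) ?_))
  intro β Γ' φ r he hr
  have h' := h.weaken he
  exact (Decides.forall_fintype fun l => .forall_fintype fun l' =>
    (Decides.const _).or (Decides.eq (hr l) (hr l')).not).and
      ((Decides.forall_fintype fun l => .eq (comp_cell h' (hr l) (.const _))
        (comp_cell h' (hr _) (.const _))).and
          (.exists_fintype fun l => .eq (hr l) (hi.weaken he)))

/-- The number of row `l` for the tuple `t`. -/
def rowNumber (C m : ℕ) (R : τ.Symbol) (t : Fin (τ.arity R) → ℕ) (l : ℕ) : ℕ :=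
  l + (R + τ.numSymbols * ∑ c, t c * m ^ (c : ℕ)) * τ.rowsPerPattern C m

/-- The tuple at position `j` of the table of `R` belongs to the output. -/
def Input.OutputBit (g C : ℕ) (R : τ.Symbol) (x : Input τ) (j : ℕ) : Prop :=
  ∃ t : Fin (τ.arity R) → ℕ, (∀ c, t c < x.card) ∧
    (¬ x.memory (τ.numCoins C) (x.card + 1 + RelStructure.tableOffset τ R x.card +
      ∑ c, t c * x.card ^ (c : ℕ)) = 0 ∧
    ∃ l < τ.rowsPerPattern C x.card, ¬ x.OnCycle g C (rowNumber C x.card R t l) ∧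
      ∑ c : Fin (τ.arity R), (x.cell C (rowNumber C x.card R t l) c + t c * fibre C x.card) *
        (x.card * fibre C x.card) ^ (c : ℕ) = j)

/-- Point `x` of the fibre over `b` has the number `x + b * fibre`, and a tuple stands at the
position whose digits in base `card * fibre` are its entries. So membership becomes an arithmetic
equation that a bounded search over `t` and `l` can test. -/
theorem Input.mem_output_iff (g C : ℕ) (R : τ.Symbol) (x : Input τ)
    (j : Fin ((x.card * fibre C x.card) ^ τ.arity R)) :
    finFunctionFinEquiv.symm j ∈ (x.output g C).rel R ↔ x.OutputBit g C R j := by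
  have hbit : ∀ t : Fin (τ.arity R) → Fin x.card,
      ¬ x.memory (τ.numCoins C) (x.card + 1 + RelStructure.tableOffset τ R x.card +
        ∑ c, (t c : ℕ) * x.card ^ (c : ℕ)) = 0 ↔ t ∈ x.struct.rel R := by
    intro t
    rw [← finFunctionFinEquiv_apply]
    refine (x.memory_table R (finFunctionFinEquiv t).2).trans ?_
    rw [Fin.eta, Equiv.symm_apply_apply]
  have hrow : ∀ (t : Fin (τ.arity R) → Fin x.card) (l : Fin (τ.rowsPerPattern C x.card)),
      rowNumber C x.card R (fun c => t c) l = (τ.rowIndex C x.card (⟨R, t⟩, l) : ℕ) := by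
    intro t l
    rw [rowIndex_val, rowNumber, mul_comm (τ.rowsPerPattern C x.card)]
  have hpos : ∀ (t : Fin (τ.arity R) → Fin x.card) (l : Fin (τ.rowsPerPattern C x.card)),
      (finFunctionFinEquiv.symm j = fun c => finProdFinEquiv (t c,
        x.array C (τ.rowIndex C x.card (⟨R, t⟩, l)) (Fin.castLE (τ.arity_le R) c))) ↔
      ∑ c : Fin (τ.arity R), (x.cell C (rowNumber C x.card R (fun c => t c) l) c +
        t c * fibre C x.card) * (x.card * fibre C x.card) ^ (c : ℕ) = j := by
    intro t l
    rw [Equiv.symm_apply_eq, eq_comm, Fin.ext_iff, finFunctionFinEquiv_apply, hrow]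
    have : ∀ c : Fin (τ.arity R), x.cell C (τ.rowIndex C x.card (⟨R, t⟩, l)) c =
        x.array C (τ.rowIndex C x.card (⟨R, t⟩, l)) (Fin.castLE (τ.arity_le R) c) :=
      fun c => x.cell_eq C _ (Fin.castLE (τ.arity_le R) c)
    simp only [this, finProdFinEquiv_apply_val, mul_comm (fibre C x.card)]
  constructor
  · rintro ⟨t, ht, l, hl, hj⟩
    refine ⟨fun c => t c, fun c => (t c).2, (hbit t).2 ht, l, l.2, ?_, (hpos t l).1 hj⟩
    rw [hrow]
    exact fun h => hl ((x.onCycle_iff _).1 h)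
  · rintro ⟨t, ht, hmem, l, hl, hcyc, hj⟩
    obtain ⟨t, rfl⟩ : ∃ t' : Fin (τ.arity R) → Fin x.card, t = fun c => (t' c : ℕ) :=
      ⟨fun c => ⟨t c, ht c⟩, rfl⟩
    refine ⟨t, (hbit t).1 hmem, ⟨l, hl⟩, fun h => hcyc ?_, (hpos t ⟨l, hl⟩).2 hj⟩
    have := hrow t ⟨l, hl⟩
    simp only at this
    rw [this]
    exact (x.onCycle_iff _).2 h

theorem decides_outputBit (g : ℕ) (R : τ.Symbol) (h : Represents C Γ X) {j : α → ℕ}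
    (hj : Comp Γ j) : Decides Γ fun x => (X x).OutputBit g C R (j x) := by
  refine .exists_vector_lt (τ.arity R) h.sized.comp (PolyTime.id.polyBounded h.sized)
    (P := fun x t => ¬ (X x).memory (τ.numCoins C) ((X x).card + 1 +
      RelStructure.tableOffset τ R (X x).card + ∑ c, t c * (X x).card ^ (c : ℕ)) = 0 ∧
    ∃ l < τ.rowsPerPattern C (X x).card, ¬ (X x).OnCycle g C (rowNumber C (X x).card R t l) ∧
      ∑ c : Fin (τ.arity R), ((X x).cell C (rowNumber C (X x).card R t l) c +
        t c * fibre C (X x).card) * ((X x).card * fibre C (X x).card) ^ (c : ℕ) = j x) ?_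
  intro β Γ' φ t he ht
  have h' := h.weaken he
  have hsum : Comp Γ' fun y => ∑ c, t c y * (X (φ y)).card ^ (c : ℕ) :=
    .sum _ fun c _ => (ht c).mul ((PolyTime.id.pow _).comp h'.sized)
      ((PolyTime.id.pow _).polyBounded h'.sized)
  refine Decides.and (Decides.eq (.load h'.mem (((h'.sized.comp.add (.const 1)).add
    ((PolyTime.tableOffset R).comp h'.sized)).add hsum)) (.const 0)).not ?_
  refine .exists_lt (P := fun y l => ¬ (X (φ y)).OnCycle g C
      (rowNumber C (X (φ y)).card R (fun c => t c y) l) ∧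
      ∑ c : Fin (τ.arity R), ((X (φ y)).cell C
        (rowNumber C (X (φ y)).card R (fun c => t c y) l) c + t c y * fibre C (X (φ y)).card) *
          ((X (φ y)).card * fibre C (X (φ y)).card) ^ (c : ℕ) = j (φ y))
    ((PolyTime.rowsPerPattern C).comp h'.sized)
    ((PolyTime.rowsPerPattern C).polyBounded h'.sized) ?_
  intro γ Γ'' ψ l he' hl
  have h'' := h'.weaken he'
  have hrow : Comp Γ'' fun z => rowNumber C (X (φ (ψ z))).card R (fun c => t c (ψ z)) (l z) :=
    hl.add (((Comp.const _).add ((Comp.mul (hsum.weaken he') (.const τ.numSymbols)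
      (.const _)).congr fun z => mul_comm _ _)).mul ((PolyTime.rowsPerPattern C).comp h''.sized)
        ((PolyTime.rowsPerPattern C).polyBounded h''.sized))
  have hN : ∀ k, PolyTime fun m => (m * fibre C m) ^ k :=
    fun k => (PolyTime.id.mul (PolyTime.fibre C)).pow k
  exact (decides_onCycle g h'' hrow).not.and (.eq (.sum _ fun c _ =>
    ((comp_cell h'' hrow (.const _)).add (((ht c).weaken he').mul
      ((PolyTime.fibre C).comp h''.sized) ((PolyTime.fibre C).polyBounded h''.sized))).mul
        ((hN _).comp h''.sized) ((hN _).polyBounded h''.sized)) ((hj.weaken he).weaken he'))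

end Expressions

theorem writes_output (g C : ℕ) {Γ : Ctx (Input τ)} (hs : Sized Γ Input.card)
    (hm : HasMem Γ (Input.memory (τ.numCoins C))) :
    Writes Γ fun x => (x.output g C).encode := by
  have hN : PolyTime fun m => m * fibre C m := PolyTime.id.mul (PolyTime.fibre C)
  exact .encode (hN.comp hs) (hN.polyBounded hs) _ (Input.OutputBit g C)
    (fun R x j => x.mem_output_iff g C R j) fun R _ Γ' φ j he hj =>
      decides_outputBit g R (X := φ) ⟨hs.weaken he, hm.weaken he⟩ hj

theorem writes_input {Γ : Ctx (Input τ)} (hs : Sized Γ Input.card)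
    (hm : HasMem Γ (Input.memory fun _ => 0)) : Writes Γ fun x => x.struct.encode := by
  refine .encode hs.comp (PolyTime.id.polyBounded hs) _
    (fun R x j => ¬ x.memory (fun _ => 0) (x.card + 1 + RelStructure.tableOffset τ R x.card + j) = 0)
    (fun R x j => (x.memory_table R j.2).symm) ?_
  intro R β Γ' φ j he hj
  have hs' := hs.weaken he
  exact (Decides.eq (.load (hm.weaken he) (((hs'.comp.add (.const 1)).add
    ((PolyTime.tableOffset R).comp hs')).add hj)) (.const 0)).not

end RAM

/-! ### The main theorem -/

namespace RelStructure

variable {τ : Signature}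

theorem isTemporalSparsification_self {V : Type*} {g : ℕ} (hg : g < 2) (B : RelStructure τ V) :
    B.IsTemporalSparsification g B := by
  refine ⟨le_girth_iff.2 ?_, ⟨id, fun _ _ h => h⟩, fun _ _ h => h⟩
  rintro n (⟨rfl, -⟩ | ⟨hn, -⟩) <;> omega

/-- If the random array has the two typical properties, then the construction succeeds. -/
theorem isTemporalSparsification_output {g C : ℕ} (x : RAM.Input τ) (hB : x.struct.Nondegenerate)
    (hC : x.card + 1 ≤ Signature.fibre C x.card)
    (hX : (cyclePoints g (x.array C)).card * (8 * (x.card + 1)) ≤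
      Fintype.card (Fin (Signature.fibre C x.card)))
    (hbox : HitsBoxes (8 * (x.card + 1)) (τ.rowIndex C x.card) (x.array C)) :
    x.struct.IsTemporalSparsification g (x.output g C) := by
  have hX' := hX
  rw [Fintype.card_fin] at hX'
  refine ⟨le_girth_sparseLift (τ.rowIndex_injective C x.card) hB, sparseLift_mapsTo, ?_⟩
  intro T hT h
  refine mapsTo_temporal_of_sparseLift_mapsTo (g := g) (hA := τ.arity_le)
    (idx := τ.rowIndex C x.card) (ω := x.array C) hB hC (cyclePoints g (x.array C)) ?_ hX' ?_ hT h
  · exact fun i hi => exists_mem_cyclePoints hi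
  · intro s S hS
    refine hbox s S fun c => ?_
    rw [Fintype.card_fin]
    exact hS c

theorem exists_program (g c : ℕ) : ∃ (p : RAM.Program) (time : Polynomial ℕ),
    ∀ (m : ℕ) (B : RelStructure τ (Fin m)), (2 ≤ g → B.Nondegenerate) →
      (∀ coins : ℕ → Bool, ∃ w, RAM.HaltsWith p B.encode coins (time.eval m) w) ∧
      1 - 1 / ((m : ℝ) + 2) ^ c ≤ RAM.prob p B.encode (time.eval m)
        {w | ∃ (N : ℕ) (C : RelStructure τ (Fin N)),
          w = C.encode ∧ B.IsTemporalSparsification g C} := by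
  have hcast : ∀ m : ℕ, ((m : ℝ) + 2) ^ c = (((m + 2) ^ c : ℕ) : ℝ) := by
    intro m; push_cast; rfl
  rcases lt_or_ge g 2 with hg | hg
  · obtain ⟨p, time, hp⟩ := RAM.exists_program_of_writes (RAM.PolyTime.const 0)
      (fun x : RAM.Input τ => x.struct.encode) fun Γ hs hm => RAM.writes_input hs hm
    refine ⟨p, time, fun m B _ => ⟨fun coins => ⟨_, (hp m).2 B coins⟩, ?_⟩⟩
    rw [hcast]
    -- No coins are needed here: the array is empty and every outcome is good.
    refine RAM.le_prob_of_arrayOfCoins (M := 0) (A := 0) (β := 0) (by positivity) (by simp) _ _ _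
      (fun _ => True) (by simp) fun ρ _ => ⟨_, ⟨m, B, rfl, isTemporalSparsification_self hg B⟩,
        (hp m).2 B _⟩
  · obtain ⟨C, hC⟩ := RAM.exists_fibreBound_le (τ := τ) g c
    obtain ⟨p, time, hp⟩ := RAM.exists_program_of_writes (RAM.PolyTime.numCoins C)
      (fun x : RAM.Input τ => (x.output g C).encode) fun Γ hs hm => RAM.writes_output g C hs hm
    refine ⟨p, time, fun m B hB => ⟨fun coins => ⟨_, (hp m).2 B coins⟩, ?_⟩⟩
    rw [hcast]
    -- The three summands of `fibreBound` serve Markov's inequality, the union bound over patterns,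
    -- and the condition `m + 1 ≤ n` for choosing comparable subsets.
    have hb := hC m
    rw [Signature.fibreBound, Signature.fibre] at hb
    refine RAM.le_prob_of_arrayOfCoins (M := τ.numRows C m) (A := τ.maxArity)
      (β := Signature.digits C m) (by positivity) (hp m).1 _ _ _
      (fun ω => (cyclePoints g ω).card * (8 * (m + 1)) ≤
          Fintype.card (Fin (2 ^ Signature.digits C m)) ∧
        HitsBoxes (8 * (m + 1)) (τ.rowIndex C m) ω) ?_ ?_
    · classical
      have hne : Nonempty (Fin (2 ^ Signature.digits C m)) := ⟨⟨0, by positivity⟩⟩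
      have := card_bad_arrays_mul_le (X := Fin (2 ^ Signature.digits C m)) (K := Fin τ.maxArity)
        (g := g) (D := 8 * (m + 1)) (W := τ.degreeBound m) (E := (m + 2) ^ c) (by omega) (by omega)
        (Nat.le_add_left 1 _) (τ.rowIndex_injective C m)
        (by rw [Fintype.card_fin, Fintype.card_fin]; rfl)
        (by
          rw [Fintype.card_fin, Fintype.card_fin, Fintype.card_fin, Signature.degreeBound,
            Signature.numRows, Signature.rowsPerPattern, Signature.fibre, add_mul]
          refine le_trans (le_of_eq ?_) (Nat.le_add_right _ _)
          ring)
        (by rw [Fintype.card_fin]; omega)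
        (by
          have := Nat.mul_le_mul_left (2 * (m + 2) ^ c) (τ.card_pattern_le m)
          rw [Fintype.card_fin]; omega)
      rw [Nat.card_eq_fintype_card, Nat.card_eq_fintype_card, Fintype.card_subtype]
      convert this
    · rintro ρ ⟨hX, hbox⟩
      exact ⟨_, ⟨_, _, rfl, isTemporalSparsification_output ⟨m, B, extendBits ρ⟩ (hB hg)
        (by change m + 1 ≤ 2 ^ Signature.digits C m; omega) hX hbox⟩, (hp m).2 B _⟩

/-- Transport of a structure along a bijection. -/
theorem IsTemporalSparsification.of_equiv {V W U : Type*} {g : ℕ} (e : V ≃ W)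
    (B : RelStructure τ V) {C : RelStructure τ U}
    (h : IsTemporalSparsification g (⟨fun R => {t | e.symm ∘ t ∈ B.rel R}⟩ : RelStructure τ W) C) :
    B.IsTemporalSparsification g C := by
  obtain ⟨h1, ⟨f, hf⟩, h3⟩ := h
  refine ⟨h1, ⟨e.symm ∘ f, fun R t ht => hf R t ht⟩, fun T hT hCT => ?_⟩
  obtain ⟨k, hk⟩ := h3 T hT hCT
  refine ⟨k ∘ e, fun R t ht => hk R (e ∘ t) ?_⟩
  have : e.symm ∘ e ∘ t = t := by
    funext i
    simp
  simpa [this] using ht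

/-- The probabilistic method: for `c = 1` the success probability is at least `1 - 1 / (m + 2) > 0`,
so some coin sequence yields a valid output. -/
theorem exists_isTemporalSparsification {V : Type*} [Finite V] (g : ℕ) (B : RelStructure τ V)
    (hB : 2 ≤ g → B.Nondegenerate) :
    ∃ (W : Type) (_ : Finite W) (C : RelStructure τ W), B.IsTemporalSparsification g C := by
  obtain ⟨m, ⟨e⟩⟩ := Finite.exists_equiv_fin V
  obtain ⟨p, time, hp⟩ := exists_program (τ := τ) g 1
  obtain ⟨-, hprob⟩ := hp m ⟨fun R => {t | e.symm ∘ t ∈ B.rel R}⟩ fun hg R t ht =>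
    Function.Injective.of_comp (hB hg R _ ht)
  have hpos : (0 : ℝ) < 1 - 1 / ((m : ℝ) + 2) ^ 1 := by
    rw [sub_pos, pow_one, div_lt_one (by positivity)]
    have : (0 : ℝ) ≤ m := Nat.cast_nonneg m
    linarith
  have hne := (hpos.trans_le hprob).ne'
  rw [RAM.prob, div_ne_zero_iff, Nat.cast_ne_zero, Nat.card_ne_zero] at hne
  obtain ⟨⟨-, w, ⟨N, C, -, hC⟩, -⟩⟩ := hne.1.1
  exact ⟨Fin N, inferInstance, C, hC.of_equiv e B⟩

end RelStructure

theorem theorem4p2 (τ : Signature) (g : ℕ) :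
    (∀ (V : Type u) [Finite V] (B : RelStructure τ V), (2 ≤ g → B.Nondegenerate) →
      ∃ (W : Type) (_ : Finite W) (C : RelStructure τ W), B.IsTemporalSparsification g C) ∧
    (∀ c : ℕ, ∃ (p : RAM.Program) (time : Polynomial ℕ),
      ∀ (m : ℕ) (B : RelStructure τ (Fin m)), (2 ≤ g → B.Nondegenerate) →
        (∀ coins : ℕ → Bool, ∃ w, RAM.HaltsWith p B.encode coins (time.eval m) w) ∧
        1 - 1 / ((m : ℝ) + 2) ^ c ≤
          RAM.prob p B.encode (time.eval m)
            {w | ∃ (N : ℕ) (C : RelStructure τ (Fin N)),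
              w = C.encode ∧ B.IsTemporalSparsification g C}) :=
  ⟨fun _ _ B hB => B.exists_isTemporalSparsification g hB,
    fun c => RelStructure.exists_program g c⟩
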